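/- **Setting.** Let $D\in\mathbb R^{N\times N}$ be a deterministic matrix (each column is a canonical basis vector; $n_j$ denotes the row of the unique $1$ in column $j$), with the states labelled so that $$D=\begin{bmatrix}P&D_{12}\\0&D_{22}\end{bmatrix},$$ where $P$ is the permutation matrix of a permutation $\sigma$ of the recurrent states $\widetilde{\mathcal X}=\{x_1,\dots,x_{N-r}\}$ ($Pu_x=u_{\sigma(x)}$) and $D_{22}\in\mathbb R^{r\times r}$ is nilpotent; the last $r$ states are the transient ones. Let $Q\in\mathbb R^{N\times N}$ satisfy $q_{ij}\ge 0$ for $i\ne n_j$ and $q_{n_jj}=-\sum_{i\neq n_j}q_{ij}$, and put $T_\varepsilon=D+\varepsilon Q$, which is column-stochastic for all small $\varepsilon>0$. Let $E\in\mathbb R^{S\times N}$ be column-stochastic and $\pi_0$ a probability vector. For every small $\varepsilon>0$ let $(\boldsymbol x^\star_k)_{k\ge0}$, $(\boldsymbol y_k)_{k\ge1}$ be a hidden Markov model with initial distribution $\pi_0$, transition probabilities $\mathbb P(\boldsymbol x^\star_{k+1}=x_i\mid \boldsymbol x^\star_k=x_j)=(T_\varepsilon)_{ij}$ and emission probabilities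 $\mathbb P(\boldsymbol y_k=u_i\mid\boldsymbol x^\star_k=x_j)=e_{ij}$, where $u_1,\dots,u_S$ are the canonical basis vectors of $\mathbb R^S$. Let $M$ be the order of $P$ and let $\widetilde E$ consist of the first $N-r$ columns of $E$. Assume that all entries of $\widetilde E$ are strictly positive and that no two columns of the stacked matrix $\widetilde E_s$ with blocks $\widetilde EP^0,\dots,\widetilde EP^{M-1}$ are identical. For $\delta\in(0,1)$ the adaptive logit filter is $$\boldsymbol w_k=\begin{bmatrix}P&0\\0&I_r\end{bmatrix}(1-\delta)\boldsymbol w_{k-1}+\delta\log(E^\top\boldsymbol y_k),\qquad w_0=\begin{bmatrix}\widetilde w_0\\-\infty\mathbb 1_r\end{bmatrix},$$ with $\widetilde w_0\in\mathbb R^{N-r}$ fixed and finite, elementwise logarithm, $\log 0=-\infty$ and $0\cdot(-\infty)=0$. Its decoding error is $p_k=\mathbb P[\arg\max_x\boldsymbol w_k(x)\ne\boldsymbol x_k^\star]$, where a tie at the maximum counts as an error. **Constants.** For distinct $x',x\in\widetilde{\mathcal X}$ and $0\le n<M$ let $\mathbb P(y\mid z)$ be the entry of $\widetilde E$ for observation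 $y$ and state $z$, let $g_n(y)=\log\frac{\mathbb P(y\mid\sigma^{-n}(x'))}{\mathbb P(y\mid\sigma^{-n}(x))}$, let $\Lambda_n(t;x',x)=\log\sum_y\mathbb P(y\mid\sigma^{-n}(x'))e^{tg_n(y)}$ and $d_n(x',x)=\sum_y\mathbb P(y\mid\sigma^{-n}(x'))g_n(y)$, and let $\Gamma(x',x)$ be the set of those $n$ for which $\mathbb P(\cdot\mid\sigma^{-n}(x))\neq\mathbb P(\cdot\mid\sigma^{-n}(x'))$. Put $$\rho(x',x)=\sum_{n\in\Gamma(x',x)}\int_0^{-1/M}\frac{\Lambda_n(\tau;x',x)}{\tau}\,d\tau,\qquad \xi=\min_{x\ne x'}\Big(-\frac1M\,\rho(x',x)\Big),$$ with $\xi=+\infty$ if there is only one recurrent state, and $W=\max\{\|\widetilde w_0\|_\infty,\max_y\|\log(\widetilde E^\top y)\|_\infty\}$, $q_{\min}=\min_jq_{n_jj}\le 0$. **Theorem.** 1. If $\delta=\delta_\varepsilon>0$ satisfies $\lim_{\varepsilon\to0}\delta_\varepsilon=0$ and $\lim_{\varepsilon\to0}\varepsilon/\delta_\varepsilon=0$,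 then $\lim_{\varepsilon\to0}\limsup_{k\to\infty}p_k=0$. 2. $\xi>0$. Let $\lambda\in(0,\xi)$ and $\delta_\varepsilon=\lambda/\log(1/\varepsilon)$. Then there is $\alpha>0$ with $$\rho(x',x)+\lambda M+e^{-\alpha}\Big(\sum_{n\in\Gamma(x',x)}\frac1M d_n(x',x)+2W\Big)<0\quad\text{for all distinct }x',x\in\widetilde{\mathcal X},$$ and for every such $\alpha$, with $\kappa=-q_{\min}\alpha/\lambda$ (which is positive if $Q\ne0$), $$\limsup_{k\to\infty}p_k\le\kappa\,\varepsilon\log\frac1\varepsilon+o\Big(\varepsilon\log\frac1\varepsilon\Big)\qquad(\varepsilon\to0^+).$$ -/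

import Mathlib

open Filter Topology MeasureTheory Matrix

noncomputable section

namespace ALF

/-- The state space: `m` recurrent states (left summand) and `r` transient states (right summand)
of the deterministic backbone. -/
abbrev State (m r : ℕ) : Type := Fin m ⊕ Fin r

/-- Every column is a canonical basis vector. -/
def IsDeterministic {X : Type*} [DecidableEq X] (D : Matrix X X ℝ) : Prop :=
  ∀ j, ∃ i, (fun a => D a j) = Pi.single i 1

/-- The constraint on the perturbation `Q`: off the row `n` holding the unique `1` of column `j` of
`D` the entries of `Q` are nonnegative, and in that row `Q` balances the column sum to zero. -/
def IsDrift {X : Type*} [Fintype X] [DecidableEq X] (D Q : Matrix X X ℝ) : Prop :=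
  ∀ j n, D n j = 1 → (∀ i, i ≠ n → 0 ≤ Q i j) ∧ Q n j = -∑ i ∈ Finset.univ.erase n, Q i j

/-- Nonnegative entries, every column sums to one. -/
def IsColumnStochastic {I J : Type*} [Fintype I] (A : Matrix I J ℝ) : Prop :=
  (∀ i j, 0 ≤ A i j) ∧ ∀ j, ∑ i, A i j = 1

/-- The permutation matrix with `P u_j = u_{σ j}`. -/
def permMat {m : ℕ} (σ : Equiv.Perm (Fin m)) : Matrix (Fin m) (Fin m) ℝ :=
  Matrix.of fun i j => if i = σ j then 1 else 0

/-- The order `M` of the permutation matrix: the least positive integer with `P ^ M = 1`. -/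
def permOrder {m : ℕ} (σ : Equiv.Perm (Fin m)) : ℕ := orderOf (permMat σ)

/-- The columns of the emission matrix at the recurrent states. -/
def recEmission {m r S : ℕ} (E : Matrix (Fin S) (State m r) ℝ) : Matrix (Fin S) (Fin m) ℝ :=
  Matrix.of fun s x => E s (Sum.inl x)

/-- The stacked matrix with blocks `F * P ^ 0, …, F * P ^ (M - 1)`. -/
def stacked {m S : ℕ} (σ : Equiv.Perm (Fin m)) (F : Matrix (Fin S) (Fin m) ℝ) :
    Matrix (Fin (permOrder σ) × Fin S) (Fin m) ℝ :=
  Matrix.of fun a x => (F * permMat σ ^ (a.1 : ℕ)) a.2 x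

/-- `X 0, X 1, …` and `Y 1, Y 2, …` form a hidden Markov model with initial distribution `π₀`,
transition matrix `T` (columns are the current state) and emission matrix `E`, given through the
joint law of `(X 0, …, X n, Y 1, …, Y n)`. The variable `Y 0` plays no role. -/
structure IsHMM {Ω : Type*} [MeasurableSpace Ω] (μ : Measure Ω) {m r S : ℕ}
    (X : ℕ → Ω → State m r) (Y : ℕ → Ω → Fin S) (π₀ : State m r → ℝ)
    (T : Matrix (State m r) (State m r) ℝ) (E : Matrix (Fin S) (State m r) ℝ) : Prop where
  prob : IsProbabilityMeasure μ
  meas_state : ∀ k, Measurable (X k)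
  meas_obs : ∀ k, Measurable (Y k)
  joint_law : ∀ (n : ℕ) (x : ℕ → State m r) (y : ℕ → Fin S),
    μ.real {ω | (∀ k ≤ n, X k ω = x k) ∧ ∀ k, 1 ≤ k → k ≤ n → Y k ω = y k}
      = π₀ (x 0) * ∏ k ∈ Finset.range n, T (x (k + 1)) (x k) * E (y (k + 1)) (x (k + 1))

/-- The initial vector: `w0` on the recurrent states, `-∞` on the transient ones. -/
def initLogit {m : ℕ} (r : ℕ) (w0 : Fin m → ℝ) : State m r → EReal :=
  Sum.elim (fun x => (w0 x : EReal)) fun _ => ⊥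

/-- One step of the filter,
`w ↦ diag(P, I_r) (1 - δ) w + δ log (Eᵀ y)`, with values in the extended reals, where
`0 * (-∞) = 0` and `log 0 = -∞`. The observation `s` enters as the basis vector `u_s`. -/
def alfStep {m r S : ℕ} (σ : Equiv.Perm (Fin m)) (E : Matrix (Fin S) (State m r) ℝ) (δ : ℝ)
    (w : State m r → EReal) (s : Fin S) : State m r → EReal := fun i =>
  (∑ j, ((Matrix.fromBlocks (permMat σ) 0 0 1 : Matrix (State m r) (State m r) ℝ) i j : EReal)
      * (((1 - δ : ℝ) : EReal) * w j))
    + (δ : EReal) * ENNReal.log (ENNReal.ofReal ((Eᵀ *ᵥ Pi.single s 1) i))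

/-- The filter driven by the observations `y 1, y 2, …`. -/
def alf {m r S : ℕ} (σ : Equiv.Perm (Fin m)) (E : Matrix (Fin S) (State m r) ℝ) (δ : ℝ)
    (w0 : Fin m → ℝ) (y : ℕ → Fin S) : ℕ → State m r → EReal
  | 0 => initLogit r w0
  | k + 1 => alfStep σ E δ (alf σ E δ w0 y k) (y (k + 1))

/-- The set of maximizers. -/
def argmax {X : Type*} (w : X → EReal) : Set X := {x | ∀ x', w x' ≤ w x}

/-- The state-decoding error `p_k`. A tie counts as an error, whatever the tie-breaking rule. -/
def errProb {Ω : Type*} [MeasurableSpace Ω] (μ : Measure Ω) {m r S : ℕ}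
    (X : ℕ → Ω → State m r) (Y : ℕ → Ω → Fin S) (σ : Equiv.Perm (Fin m))
    (E : Matrix (Fin S) (State m r) ℝ) (w0 : Fin m → ℝ) (δ : ℝ) (k : ℕ) : ℝ :=
  μ.real {ω | argmax (alf σ E δ w0 (fun i => Y i ω) k) ≠ {X k ω}}

/-- The log-likelihood ratio of the observation `s` between the states `σ^{-n} x'` and `σ^{-n} x`. -/
def logRatio {m S : ℕ} (σ : Equiv.Perm (Fin m)) (F : Matrix (Fin S) (Fin m) ℝ)
    (x' x : Fin m) (n : ℕ) (s : Fin S) : ℝ :=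
  Real.log (F s ((σ ^ (-(n : ℤ))) x') / F s ((σ ^ (-(n : ℤ))) x))

/-- `Λ_n(t)`: the logarithmic moment generating function of the log-likelihood ratio when the
observation is emitted from `σ^{-n} x'`. -/
def logMGF {m S : ℕ} (σ : Equiv.Perm (Fin m)) (F : Matrix (Fin S) (Fin m) ℝ)
    (x' x : Fin m) (n : ℕ) (t : ℝ) : ℝ :=
  Real.log (∑ s, F s ((σ ^ (-(n : ℤ))) x') * Real.exp (t * logRatio σ F x' x n s))

/-- `d_n`: the mean of the log-likelihood ratio, a Kullback–Leibler divergence. -/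
def klDiv {m S : ℕ} (σ : Equiv.Perm (Fin m)) (F : Matrix (Fin S) (Fin m) ℝ)
    (x' x : Fin m) (n : ℕ) : ℝ :=
  ∑ s, F s ((σ ^ (-(n : ℤ))) x') * logRatio σ F x' x n s

open Classical in
/-- The lags `n < M` at which the emission distributions from `x'` and `x` differ. -/
def lagSet {m S : ℕ} (σ : Equiv.Perm (Fin m)) (F : Matrix (Fin S) (Fin m) ℝ)
    (x' x : Fin m) : Finset ℕ :=
  (Finset.range (permOrder σ)).filter fun n =>
    ∃ s, F s ((σ ^ (-(n : ℤ))) x) ≠ F s ((σ ^ (-(n : ℤ))) x')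

/-- `∑_{n ∈ Γ} ∫_0^{-1/M} Λ_n(τ) / τ dτ`. -/
def rateIntegral {m S : ℕ} (σ : Equiv.Perm (Fin m)) (F : Matrix (Fin S) (Fin m) ℝ)
    (x' x : Fin m) : ℝ :=
  ∑ n ∈ lagSet σ F x' x, ∫ τ in (0 : ℝ)..(-(1 / (permOrder σ : ℝ))), logMGF σ F x' x n τ / τ

/-- The constant `ξ`: the minimum of `-(1/M) ∑_n ∫_0^{-1/M} Λ_n(τ) / τ dτ` over pairs of distinct
recurrent states (`+∞` if there is only one recurrent state). -/
def xi {m S : ℕ} (σ : Equiv.Perm (Fin m)) (F : Matrix (Fin S) (Fin m) ℝ) : EReal :=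
  ⨅ (x' : Fin m) (x : Fin m) (_ : x ≠ x'),
    ((-(1 / (permOrder σ : ℝ)) * rateIntegral σ F x' x : ℝ) : EReal)

/-- `W = max {‖w0‖_∞, max_y ‖log (Fᵀ y)‖_∞}`; norms of functions on finite sets are sup norms. -/
def logitBound {m S : ℕ} (F : Matrix (Fin S) (Fin m) ℝ) (w0 : Fin m → ℝ) : ℝ :=
  max ‖w0‖ ‖fun (s : Fin S) (x : Fin m) => Real.log (F s x)‖

/-- The window parameter `α > 0` is large enough for the rate `lam`. -/
def IsLargeWindow {m S : ℕ} (σ : Equiv.Perm (Fin m)) (F : Matrix (Fin S) (Fin m) ℝ)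
    (w0 : Fin m → ℝ) (lam α : ℝ) : Prop :=
  0 < α ∧ ∀ x' x : Fin m, x ≠ x' →
    rateIntegral σ F x' x + lam * permOrder σ
      + Real.exp (-α) * (∑ n ∈ lagSet σ F x' x, 1 / (permOrder σ : ℝ) * klDiv σ F x' x n
          + 2 * logitBound F w0) < 0

/-- `q_min = min_j q_{n_j j}`; for a deterministic `D` the inner sum is the entry `q_{n_j j}`. -/
def qMin {X : Type*} [Fintype X] (D Q : Matrix X X ℝ) : ℝ := ⨅ j, ∑ i, D i j * Q i j

/-- The constant `κ = -q_min α / lam`. -/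
def kappa {X : Type*} [Fintype X] (D Q : Matrix X X ℝ) (lam α : ℝ) : ℝ := -qMin D Q * α / lam

end ALF

end

noncomputable section

namespace ALF

/-! An error at time `k` has two sources. Take the window of the last `K = ⌈α/δ⌉` steps, preceded by
`L` steps, enough for the backbone to carry every state into the recurrent class. Either the chain
leaves the backbone during these `K + L` steps; a union bound gives this probability at most `-q_min
ε (K + L)`, the source of `κ ε log(1/ε)`. Or the last `K` states form a recurrent orbit `σ^{-n} x'`
and some `x ≠ x'` has at least as large a logit (`IsHMM.errProb_le`).

In the second case, unrolling the filter bounds the discounted sum of log-likelihood ratios `∑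
(1-δ)^n g_n(y_{k-n})` by `(1-δ)^K 2W/δ` (`window_sum_le_of_recLogit_le`). Chernoff's bound with
parameter `1/M` then produces the exponent `∑_{n<K} Λ_n(-(1-δ)^n/M)` (`IsHMM.measureReal_pair_le`).
Since `Λ_n` is `M`-periodic in `n`, this is close to a Riemann sum, and the substitution `τ =
-e^{-s}/M` turns its limit into the integrals of `ρ`, except for the piece near `τ = 0` that the
window misses; Jensen controls that piece by `d_n` (`exists_sum_logMGF_le`). The large-window
condition makes the total exponent at most `C - (λ+η)/δ` with `η > 0` (`exists_window_exponent_le`).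
For `δ = λ/log(1/ε)` the second probability is therefore `O(ε^{1+η/λ})`. For the first claim `λ = 0`
suffices, because `ε/δ → 0` already removes the first source.

Positivity of `ξ` is a convexity fact: `Λ_n ≤ 0` on `[-1, 0]`, strictly inside at lags where the
emissions differ, and observability supplies such a lag for every pair. -/

/-- The logarithmic moment generating function of `g` under the weights `p`. -/
def cgf {ι : Type*} [Fintype ι] (p g : ι → ℝ) (t : ℝ) : ℝ :=
  Real.log (∑ s, p s * Real.exp (t * g s))

/-! ### Logarithmic moment generating functions of log-likelihood ratios -/

section cgf

variable {ι : Type*} [Fintype ι] {p q g : ι → ℝ}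

lemma sum_exp_pos (hp : ∀ s, 0 < p s) (h1 : ∑ s, p s = 1) (t : ℝ) :
    0 < ∑ s, p s * Real.exp (t * g s) := by
  refine Finset.sum_pos (fun s _ => mul_pos (hp s) (Real.exp_pos _)) ?_
  by_contra h
  rw [Finset.not_nonempty_iff_eq_empty] at h
  rw [h] at h1
  simp at h1

lemma exp_cgf (hp : ∀ s, 0 < p s) (h1 : ∑ s, p s = 1) (t : ℝ) :
    Real.exp (cgf p g t) = ∑ s, p s * Real.exp (t * g s) :=
  Real.exp_log (sum_exp_pos hp h1 t)

/-- Replacing `u` by `t` multiplies each summand by at most `exp (B * |t - u|)`. -/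
lemma cgf_le_add (hp : ∀ s, 0 < p s) (h1 : ∑ s, p s = 1) {B : ℝ} (hg : ∀ s, |g s| ≤ B)
    (t u : ℝ) : cgf p g t ≤ cgf p g u + B * |t - u| := by
  unfold cgf
  rw [← Real.log_exp (B * |t - u|),
    ← Real.log_mul (sum_exp_pos hp h1 u).ne' (Real.exp_pos _).ne']
  refine Real.log_le_log (sum_exp_pos hp h1 t) ?_
  rw [Finset.sum_mul]
  refine Finset.sum_le_sum fun s _ => ?_
  rw [mul_assoc, ← Real.exp_add]
  refine mul_le_mul_of_nonneg_left (Real.exp_le_exp.2 ?_) (hp s).le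
  have : (t - u) * g s ≤ |t - u| * B := by
    refine (le_abs_self _).trans ?_
    rw [abs_mul]
    exact mul_le_mul_of_nonneg_left (hg s) (abs_nonneg _)
  linarith

lemma abs_cgf_sub_le (hp : ∀ s, 0 < p s) (h1 : ∑ s, p s = 1) {B : ℝ} (hg : ∀ s, |g s| ≤ B)
    (t u : ℝ) : |cgf p g t - cgf p g u| ≤ B * |t - u| := by
  rw [abs_sub_le_iff]
  constructor
  · linarith [cgf_le_add hp h1 hg t u]
  · rw [abs_sub_comm t u]
    linarith [cgf_le_add hp h1 hg u t]

lemma cgf_zero (h1 : ∑ s, p s = 1) : cgf p g 0 = 0 := by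
  simp [cgf, h1]

lemma continuous_cgf (hp : ∀ s, 0 < p s) (h1 : ∑ s, p s = 1) : Continuous (cgf p g) := by
  unfold cgf
  refine Continuous.log ?_ fun t => (sum_exp_pos hp h1 t).ne'
  fun_prop

/-- Jensen's inequality for `exp`. It later bounds the part of the rate integral near `0`. -/
lemma mul_mean_le_cgf (hp : ∀ s, 0 < p s) (h1 : ∑ s, p s = 1) (t : ℝ) :
    t * ∑ s, p s * g s ≤ cgf p g t := by
  unfold cgf
  rw [Real.le_log_iff_exp_le (sum_exp_pos hp h1 t)]
  have := convexOn_exp.map_sum_le (t := Finset.univ) (w := p) (p := fun s => t * g s)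
    (fun s _ => (hp s).le) h1 (fun s _ => Set.mem_univ _)
  simp only [smul_eq_mul] at this
  have e : t * ∑ s, p s * g s = ∑ s, p s * (t * g s) := by
    rw [Finset.mul_sum]
    exact Finset.sum_congr rfl fun s _ => by ring
  rwa [e]

/-- The summand is `a^(1+t) b^(-t)`, for `t` in `[-1, 0]` a weighted geometric mean. The next two
lemmas compare it with the arithmetic mean, whose sum over two probability vectors is `1`. -/
lemma mul_exp_log_div_eq {a b : ℝ} (ha : 0 < a) (hb : 0 < b) (t : ℝ) :
    a * Real.exp (t * Real.log (a / b))
      = Real.exp ((1 + t) * Real.log a + (-t) * Real.log b) := by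
  rw [Real.log_div ha.ne' hb.ne']
  nth_rw 1 [← Real.exp_log ha]
  rw [← Real.exp_add]
  congr 1
  ring

lemma mul_exp_log_div_lt {a b : ℝ} (ha : 0 < a) (hb : 0 < b) (hab : a ≠ b) {t : ℝ}
    (ht : -1 < t) (ht0 : t < 0) :
    a * Real.exp (t * Real.log (a / b)) < (1 + t) * a + (-t) * b := by
  rw [mul_exp_log_div_eq ha hb]
  have := strictConvexOn_exp.2 (Set.mem_univ (Real.log a)) (Set.mem_univ (Real.log b))
    (fun h => hab (Real.log_injOn_pos ha hb h)) (by linarith : 0 < 1 + t)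
    (by linarith : 0 < -t) (by ring)
  simpa only [smul_eq_mul, Real.exp_log ha, Real.exp_log hb] using this

lemma mul_exp_log_div_le {a b : ℝ} (ha : 0 < a) (hb : 0 < b) {t : ℝ}
    (ht : -1 ≤ t) (ht0 : t ≤ 0) :
    a * Real.exp (t * Real.log (a / b)) ≤ (1 + t) * a + (-t) * b := by
  rw [mul_exp_log_div_eq ha hb]
  have := convexOn_exp.2 (Set.mem_univ (Real.log a)) (Set.mem_univ (Real.log b))
    (by linarith : 0 ≤ 1 + t) (by linarith : 0 ≤ -t) (by ring)
  simpa only [smul_eq_mul, Real.exp_log ha, Real.exp_log hb] using this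

lemma sum_affine (h1 : ∑ s, p s = 1) (h1' : ∑ s, q s = 1) (t : ℝ) :
    ∑ s, ((1 + t) * p s + (-t) * q s) = 1 := by
  rw [Finset.sum_add_distrib, ← Finset.mul_sum, ← Finset.mul_sum, h1, h1']
  ring

lemma cgf_llr_nonpos (hp : ∀ s, 0 < p s) (h1 : ∑ s, p s = 1) (hq : ∀ s, 0 < q s)
    (h1' : ∑ s, q s = 1) {t : ℝ} (ht : -1 ≤ t) (ht0 : t ≤ 0) :
    cgf p (fun s => Real.log (p s / q s)) t ≤ 0 := by
  refine Real.log_nonpos (sum_exp_pos hp h1 t).le ?_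
  rw [← sum_affine h1 h1' t]
  exact Finset.sum_le_sum fun s _ => mul_exp_log_div_le (hp s) (hq s) ht ht0

lemma cgf_llr_neg (hp : ∀ s, 0 < p s) (h1 : ∑ s, p s = 1) (hq : ∀ s, 0 < q s)
    (h1' : ∑ s, q s = 1) (hpq : ∃ s, p s ≠ q s) {t : ℝ} (ht : -1 < t) (ht0 : t < 0) :
    cgf p (fun s => Real.log (p s / q s)) t < 0 := by
  refine Real.log_neg (sum_exp_pos hp h1 t) ?_
  rw [← sum_affine h1 h1' t]
  obtain ⟨s, hs⟩ := hpq
  exact Finset.sum_lt_sum (fun s _ => mul_exp_log_div_le (hp s) (hq s) ht.le ht0.le)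
    ⟨s, Finset.mem_univ _, mul_exp_log_div_lt (hp s) (hq s) hs ht ht0⟩

end cgf

/-! ### Riemann sums with a periodically varying integrand -/

section riemann

lemma sum_range_shift_eq {M : ℕ} {c : ℕ → ℝ} (hc : ∀ n, c (n + M) = c n) (K : ℕ) :
    ∑ n ∈ Finset.range M, c (K + n) = ∑ n ∈ Finset.range M, c n := by
  induction K with
  | zero => simp
  | succ K ih =>
    rw [← ih]
    have h1 := Finset.sum_range_succ (fun n => c (K + n)) M
    have h2 := Finset.sum_range_succ' (fun n => c (K + n)) M
    rw [h1, hc, add_zero] at h2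
    have : ∀ n, c (K + 1 + n) = c (K + (n + 1)) := fun n => by congr 1; ring
    simp only [this]
    linarith

/-- Telescoping with stride `M`: only the first and last `M` terms survive. -/
lemma sum_range_sub_shift (a : ℕ → ℝ) (K M : ℕ) :
    ∑ n ∈ Finset.range K, (a (n + M) - a n)
      = ∑ n ∈ Finset.range M, (a (K + n) - a n) := by
  induction K with
  | zero => simp
  | succ K ih =>
    rw [Finset.sum_range_succ, ih]
    have h1 := Finset.sum_range_succ (fun n => a (K + n)) M
    have h2 := Finset.sum_range_succ' (fun n => a (K + n)) M
    have : ∀ n, a (K + 1 + n) = a (K + (n + 1)) := fun n => by congr 1; ring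
    simp only [this, Finset.sum_sub_distrib]
    rw [add_zero] at h2
    linarith

/-- A Riemann sum whose integrand depends on the residue of the index modulo `M` is, up to an
error of the order of the mesh, at most the sum of the integrals. -/
lemma periodic_riemann_sum_le {M : ℕ} {h : ℕ → ℝ → ℝ} (hper : ∀ n, h (n + M) = h n)
    (hcont : ∀ n, Continuous (h n)) {L H : ℝ}
    (hlip : ∀ n s t, 0 ≤ s → 0 ≤ t → |h n s - h n t| ≤ L * |s - t|)
    (hneg : ∀ n s, 0 ≤ s → h n s ≤ 0) (hbd : ∀ n s, 0 ≤ s → -H ≤ h n s) (hL : 0 ≤ L) (hH : 0 ≤ H)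
    {β α : ℝ} (hβ : 0 < β) (hα : 0 ≤ α) {K : ℕ} (hK : α ≤ β * K) :
    M * β * ∑ n ∈ Finset.range K, h n (β * n)
      ≤ ∑ n ∈ Finset.range M, (∫ s in (0 : ℝ)..α, h n s) + M * (H * (β * M))
        + K * (L * (M * β) ^ 2) := by
  have hint : ∀ n a b, IntervalIntegrable (h n) volume a b :=
    fun n a b => (hcont n).intervalIntegrable a b
  have hMβ : 0 ≤ (M : ℝ) * β := by positivity
  -- Since `h (n + M) = h n`, the difference `a (n + M) - a n` is the integral of the single
  -- function `h n` over an interval of length `M * β` starting at the node `β * n`. Each residue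
  -- class is thus sampled with mesh `M * β`.
  set a : ℕ → ℝ := fun n => ∫ s in (0 : ℝ)..(β * n), h n s with ha
  have hstep : ∀ n, M * β * h n (β * n) ≤ a (n + M) - a n + L * (M * β) ^ 2 := by
    intro n
    have e1 : a (n + M) - a n = ∫ s in (β * n)..(β * n + M * β), h n s := by
      simp only [ha, hper]
      rw [intervalIntegral.integral_interval_sub_left (hint _ _ _) (hint _ _ _)]
      congr 1
      push_cast
      ring
    have e2 : ∫ s in (β * n)..(β * n + M * β), (h n (β * n) - L * (M * β))
        ≤ ∫ s in (β * n)..(β * n + M * β), h n s := by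
      refine intervalIntegral.integral_mono_on (by linarith) (by simp) (hint _ _ _) ?_
      intro s hs
      have h0 : 0 ≤ β * n := by positivity
      have h3 := hlip n (β * n) s h0 (h0.trans hs.1)
      have h4 : |β * n - s| ≤ M * β := by
        rw [abs_le]; constructor <;> linarith [hs.1, hs.2]
      have h5 := mul_le_mul_of_nonneg_left h4 hL
      have h6 := le_abs_self (h n (β * n) - h n s)
      linarith
    rw [intervalIntegral.integral_const, smul_eq_mul, ← e1] at e2
    nlinarith
  -- After telescoping, the upper endpoint lies beyond `α`, where the excess can be dropped because
  -- `h ≤ 0`; the lower endpoint is at most `β * M`, which costs `H * (β * M)`.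
  have hK1 : ∀ n ∈ Finset.range M, a (K + n) - a n
      ≤ (∫ s in (0 : ℝ)..α, h (K + n) s) + H * (β * M) := by
    intro n hn
    have hnM : (n : ℝ) ≤ M := by exact_mod_cast (Finset.mem_range.1 hn).le
    have h1 : a (K + n) ≤ ∫ s in (0 : ℝ)..α, h (K + n) s := by
      have hle : α ≤ β * ((K + n : ℕ) : ℝ) := by
        push_cast
        nlinarith [(Nat.cast_nonneg n : (0 : ℝ) ≤ n)]
      have : (∫ s in (0 : ℝ)..α, h (K + n) s)
          + ∫ s in α..(β * ((K + n : ℕ) : ℝ)), h (K + n) s = a (K + n) :=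
        intervalIntegral.integral_add_adjacent_intervals (hint _ _ _) (hint _ _ _)
      have h2 : ∫ s in α..(β * ((K + n : ℕ) : ℝ)), h (K + n) s ≤ 0 := by
        have := intervalIntegral.integral_mono_on hle (hint (K + n) _ _)
          (intervalIntegrable_const (c := (0 : ℝ))) fun s hs => hneg (K + n) s (hα.trans hs.1)
        simpa using this
      linarith
    have h2 : -(H * (β * M)) ≤ a n := by
      have hle : (0 : ℝ) ≤ β * n := by positivity
      have := intervalIntegral.integral_mono_on hle
          (intervalIntegrable_const (c := -H)) (hint n _ _) fun s hs => hbd n s hs.1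
      rw [intervalIntegral.integral_const, smul_eq_mul, sub_zero] at this
      have h3 : H * (β * n) ≤ H * (β * M) := by gcongr
      have h4 : β * n * -H ≤ a n := this
      linarith
    linarith
  calc M * β * ∑ n ∈ Finset.range K, h n (β * n)
      = ∑ n ∈ Finset.range K, M * β * h n (β * n) := Finset.mul_sum _ _ _
    _ ≤ ∑ n ∈ Finset.range K, (a (n + M) - a n + L * (M * β) ^ 2) :=
        Finset.sum_le_sum fun n _ => hstep n
    _ = ∑ n ∈ Finset.range M, (a (K + n) - a n) + K * (L * (M * β) ^ 2) := by
        rw [Finset.sum_add_distrib, sum_range_sub_shift]; simp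
    _ ≤ ∑ n ∈ Finset.range M, ((∫ s in (0 : ℝ)..α, h (K + n) s) + H * (β * M))
        + K * (L * (M * β) ^ 2) := by
        gcongr with n hn; exact hK1 n hn
    _ = _ := by
        rw [Finset.sum_add_distrib,
          sum_range_shift_eq (c := fun n => ∫ s in (0 : ℝ)..α, h n s) (fun n => by rw [hper])]
        simp

end riemann

/-! ### The order of the permutation and the stacked matrix -/

section perm

variable {m : ℕ}

lemma permMat_mul (σ τ : Equiv.Perm (Fin m)) : permMat (σ * τ) = permMat σ * permMat τ := by
  ext i j
  simp only [permMat, Matrix.mul_apply, Matrix.of_apply, Equiv.Perm.coe_mul, Function.comp_apply]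
  rw [Finset.sum_eq_single (τ j)] <;> simp +contextual
  congr

lemma permMat_one : permMat (1 : Equiv.Perm (Fin m)) = 1 := by
  ext i j
  simp only [permMat, Matrix.one_apply, Matrix.of_apply, Equiv.Perm.coe_one, id]
  congr

/-- `permMat` as a homomorphism of monoids. -/
def permMatHom : Equiv.Perm (Fin m) →* Matrix (Fin m) (Fin m) ℝ where
  toFun := permMat
  map_one' := permMat_one
  map_mul' := permMat_mul

lemma permMat_pow (σ : Equiv.Perm (Fin m)) (n : ℕ) : permMat σ ^ n = permMat (σ ^ n) :=
  (map_pow permMatHom σ n).symm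

lemma permMat_injective : Function.Injective (permMat (m := m)) := by
  intro σ τ h
  ext j
  have := congrFun (congrFun h (σ j)) j
  by_contra hne
  have hne' : σ j ≠ τ j := fun h => hne (by rw [h])
  simp [permMat, hne'] at this

lemma permOrder_eq (σ : Equiv.Perm (Fin m)) : permOrder σ = orderOf σ :=
  orderOf_injective permMatHom permMat_injective σ

lemma permOrder_pos (σ : Equiv.Perm (Fin m)) : 0 < permOrder σ := by
  rw [permOrder_eq]; exact orderOf_pos σ

lemma pow_permOrder (σ : Equiv.Perm (Fin m)) : σ ^ permOrder σ = 1 := by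
  rw [permOrder_eq, pow_orderOf_eq_one]

lemma inv_permOrder_pos (σ : Equiv.Perm (Fin m)) : 0 < 1 / (permOrder σ : ℝ) := by
  have := permOrder_pos σ
  positivity

lemma inv_permOrder_le_one (σ : Equiv.Perm (Fin m)) : 1 / (permOrder σ : ℝ) ≤ 1 := by
  have : (1 : ℝ) ≤ permOrder σ := by exact_mod_cast permOrder_pos σ
  rw [div_le_one (by linarith)]
  exact this

lemma zpow_neg_add_permOrder (σ : Equiv.Perm (Fin m)) (n : ℕ) :
    σ ^ (-((n + permOrder σ : ℕ) : ℤ)) = σ ^ (-(n : ℤ)) := by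
  rw [permOrder_eq, Nat.cast_add, neg_add, _root_.zpow_add, _root_.zpow_neg σ (orderOf σ : ℤ), zpow_natCast,
    pow_orderOf_eq_one, inv_one, mul_one]

lemma mul_permMat_apply {S : ℕ} (F : Matrix (Fin S) (Fin m) ℝ) (σ : Equiv.Perm (Fin m))
    (s : Fin S) (x : Fin m) : (F * permMat σ) s x = F s (σ x) := by
  simp [permMat, Matrix.mul_apply]

lemma stacked_apply {S : ℕ} (F : Matrix (Fin S) (Fin m) ℝ) (σ : Equiv.Perm (Fin m))
    (a : Fin (permOrder σ) × Fin S) (x : Fin m) :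
    stacked σ F a x = F a.2 ((σ ^ (a.1 : ℕ)) x) := by
  simp only [stacked, Matrix.of_apply, permMat_pow, mul_permMat_apply]

end perm

/-! ### The rate integral and the Chernoff exponent -/

section rate

variable {m S : ℕ} {σ : Equiv.Perm (Fin m)} {F : Matrix (Fin S) (Fin m) ℝ} {x' x : Fin m}

lemma logMGF_add_permOrder (n : ℕ) :
    logMGF σ F x' x (n + permOrder σ) = logMGF σ F x' x n := by
  unfold logMGF logRatio
  simp only [zpow_neg_add_permOrder]

lemma logRatio_eq_zero (hF : ∀ s x, 0 < F s x) {n : ℕ}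
    (hn : n ∈ Finset.range (permOrder σ)) (hn' : n ∉ lagSet σ F x' x) (s : Fin S) :
    logRatio σ F x' x n s = 0 := by
  classical
  simp only [lagSet, Finset.mem_filter, hn, true_and, not_exists, not_not] at hn'
  rw [logRatio, hn' s, div_self (hF _ _).ne', Real.log_one]

lemma logMGF_eq_zero (hF : ∀ s x, 0 < F s x) (h1 : ∀ x, ∑ s, F s x = 1) {n : ℕ}
    (hn : n ∈ Finset.range (permOrder σ)) (hn' : n ∉ lagSet σ F x' x) (t : ℝ) :
    logMGF σ F x' x n t = 0 := by
  simp [logMGF, logRatio_eq_zero hF hn hn', h1]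

lemma lagSet_subset : lagSet σ F x' x ⊆ Finset.range (permOrder σ) := by
  classical
  exact Finset.filter_subset _ _

lemma lagSet_nonempty
    (h : ∃ a, stacked σ F a x ≠ stacked σ F a x') : (lagSet σ F x' x).Nonempty := by
  classical
  obtain ⟨⟨a, s⟩, h⟩ := h
  rw [stacked_apply, stacked_apply] at h
  have hM := permOrder_pos σ
  -- The stacked matrix has forward powers of `σ`, `lagSet` backward ones; the lag `M - a` converts
  -- them, and the remainder handles `a = 0`.
  refine ⟨(permOrder σ - a) % permOrder σ, ?_⟩
  have key : σ ^ (-(((permOrder σ - a) % permOrder σ : ℕ) : ℤ)) = σ ^ (a : ℕ) := by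
    rw [_root_.zpow_neg, zpow_natCast, inv_eq_iff_mul_eq_one,
      ← pow_eq_pow_mod _ (pow_permOrder σ), ← pow_add, Nat.sub_add_cancel a.2.le, pow_permOrder]
  simp only [lagSet, Finset.mem_filter, Finset.mem_range]
  exact ⟨Nat.mod_lt _ hM, s, by rw [key]; exact h⟩

lemma abs_log_le_logitBound (w0 : Fin m → ℝ) (s : Fin S) (x : Fin m) :
    |Real.log (F s x)| ≤ logitBound F w0 := by
  refine le_trans ?_ (le_max_right _ _)
  rw [← Real.norm_eq_abs]
  exact (norm_le_pi_norm (fun x => Real.log (F s x)) x).trans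
    (norm_le_pi_norm (fun (s : Fin S) (x : Fin m) => Real.log (F s x)) s)

lemma abs_init_le_logitBound (w0 : Fin m → ℝ) (x : Fin m) : |w0 x| ≤ logitBound F w0 :=
  (norm_le_pi_norm w0 x).trans (le_max_left _ _)

lemma logitBound_nonneg (w0 : Fin m → ℝ) : 0 ≤ logitBound F w0 :=
  (norm_nonneg _).trans (le_max_left _ _)

lemma abs_logRatio_le (hF : ∀ s x, 0 < F s x) (w0 : Fin m → ℝ) (n : ℕ) (s : Fin S) :
    |logRatio σ F x' x n s| ≤ 2 * logitBound F w0 := by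
  rw [logRatio, Real.log_div (hF _ _).ne' (hF _ _).ne']
  refine (abs_sub _ _).trans ?_
  rw [two_mul]
  exact add_le_add (abs_log_le_logitBound w0 _ _) (abs_log_le_logitBound w0 _ _)

lemma logMGF_eq_cgf (n : ℕ) : logMGF σ F x' x n
    = cgf (fun s => F s ((σ ^ (-(n : ℤ))) x')) (logRatio σ F x' x n) := rfl

lemma continuous_logMGF (hF : ∀ s x, 0 < F s x) (h1 : ∀ x, ∑ s, F s x = 1) (n : ℕ) :
    Continuous (logMGF σ F x' x n) :=
  continuous_cgf (fun s => hF s _) (h1 _)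

lemma abs_logMGF_sub_le (hF : ∀ s x, 0 < F s x) (h1 : ∀ x, ∑ s, F s x = 1) (w0 : Fin m → ℝ)
    (n : ℕ) (t u : ℝ) :
    |logMGF σ F x' x n t - logMGF σ F x' x n u| ≤ 2 * logitBound F w0 * |t - u| :=
  abs_cgf_sub_le (fun s => hF s _) (h1 _) (abs_logRatio_le hF w0 n) t u

lemma abs_logMGF_le (hF : ∀ s x, 0 < F s x) (h1 : ∀ x, ∑ s, F s x = 1) (w0 : Fin m → ℝ)
    (n : ℕ) (t : ℝ) : |logMGF σ F x' x n t| ≤ 2 * logitBound F w0 * |t| := by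
  have := abs_logMGF_sub_le (σ := σ) (x' := x') (x := x) hF h1 w0 n t 0
  rwa [logMGF_eq_cgf, cgf_zero (h1 _), sub_zero, sub_zero] at this

lemma logMGF_nonpos (hF : ∀ s x, 0 < F s x) (h1 : ∀ x, ∑ s, F s x = 1) (n : ℕ) {t : ℝ}
    (ht : -1 ≤ t) (ht0 : t ≤ 0) : logMGF σ F x' x n t ≤ 0 :=
  cgf_llr_nonpos (fun s => hF s _) (h1 _) (fun s => hF s _) (h1 _) ht ht0

lemma logMGF_neg (hF : ∀ s x, 0 < F s x) (h1 : ∀ x, ∑ s, F s x = 1) {n : ℕ}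
    (hn : n ∈ lagSet σ F x' x) {t : ℝ} (ht : -1 < t) (ht0 : t < 0) :
    logMGF σ F x' x n t < 0 := by
  classical
  simp only [lagSet, Finset.mem_filter] at hn
  obtain ⟨s, hs⟩ := hn.2
  exact cgf_llr_neg (fun s => hF s _) (h1 _) (fun s => hF s _) (h1 _) ⟨s, hs.symm⟩ ht ht0

lemma mul_klDiv_le_logMGF (hF : ∀ s x, 0 < F s x) (h1 : ∀ x, ∑ s, F s x = 1) (n : ℕ) (t : ℝ) :
    t * klDiv σ F x' x n ≤ logMGF σ F x' x n t :=
  mul_mean_le_cgf (fun s => hF s _) (h1 _) t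

lemma intervalIntegrable_logMGF_div (hF : ∀ s x, 0 < F s x) (h1 : ∀ x, ∑ s, F s x = 1)
    (n : ℕ) (a b : ℝ) :
    IntervalIntegrable (fun τ => logMGF σ F x' x n τ / τ) volume a b := by
  rw [intervalIntegrable_iff]
  -- `|Λ_n(τ)| ≤ 2W|τ|` removes the singularity at `0`. Only the emission part of `W` matters, hence
  -- the initial vector `0`.
  refine Measure.integrableOn_of_bounded (M := 2 * logitBound F (0 : Fin m → ℝ))
    (by simp [Set.uIoc]) ?_ (Eventually.of_forall fun τ => ?_)
  · exact ((continuous_logMGF hF h1 n).measurable.div measurable_id).aestronglyMeasurable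
  · rw [Real.norm_eq_abs, abs_div]
    exact div_le_of_le_mul₀ (abs_nonneg _)
      (mul_nonneg zero_le_two (logitBound_nonneg _)) (abs_logMGF_le hF h1 _ n τ)

/-- The integrand is a quotient of two negative numbers, but the integral runs leftwards from `0`.
-/
lemma integral_logMGF_div_neg (hF : ∀ s x, 0 < F s x) (h1 : ∀ x, ∑ s, F s x = 1) {n : ℕ}
    (hn : n ∈ lagSet σ F x' x) :
    ∫ τ in (0 : ℝ)..(-(1 / (permOrder σ : ℝ))), logMGF σ F x' x n τ / τ < 0 := by
  rw [intervalIntegral.integral_symm, neg_lt_zero]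
  have h := inv_permOrder_pos σ
  have h' := inv_permOrder_le_one σ
  refine intervalIntegral.intervalIntegral_pos_of_pos_on
    (intervalIntegrable_logMGF_div hF h1 n _ _) ?_ (by linarith)
  intro τ hτ
  exact div_pos_of_neg_of_neg (logMGF_neg hF h1 hn (by linarith [hτ.1]) hτ.2) hτ.2

lemma rateIntegral_neg (hF : ∀ s x, 0 < F s x) (h1 : ∀ x, ∑ s, F s x = 1)
    (h : ∃ a, stacked σ F a x ≠ stacked σ F a x') : rateIntegral σ F x' x < 0 :=
  Finset.sum_neg (fun _ hn => integral_logMGF_div_neg hF h1 hn) (lagSet_nonempty h)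

lemma xi_pos (hF : ∀ s x, 0 < F s x) (h1 : ∀ x, ∑ s, F s x = 1)
    (h : ∀ x x' : Fin m, x ≠ x' → ∃ a, stacked σ F a x ≠ stacked σ F a x') :
    0 < xi σ F := by
  have hpos : ∀ x' x : Fin m, x ≠ x' → 0 < -(1 / (permOrder σ : ℝ)) * rateIntegral σ F x' x :=
    fun x' x hx => mul_pos_of_neg_of_neg (neg_lt_zero.2 (inv_permOrder_pos σ))
      (rateIntegral_neg hF h1 (h x x' hx))
  have : ∃ c : ℝ, 0 < c ∧ ∀ x' x : Fin m, x ≠ x' →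
      c ≤ -(1 / (permOrder σ : ℝ)) * rateIntegral σ F x' x := by
    -- The dummy value `1` on the diagonal keeps the minimum over all pairs positive.
    set f : Fin m × Fin m → ℝ := fun p =>
      if p.2 ≠ p.1 then -(1 / (permOrder σ : ℝ)) * rateIntegral σ F p.1 p.2 else 1 with hf
    rcases isEmpty_or_nonempty (Fin m × Fin m) with he | hne
    · exact ⟨1, one_pos, fun x' x _ => (he.false (x', x)).elim⟩
    · obtain ⟨p, hp⟩ := Finite.exists_min f
      refine ⟨f p, ?_, fun x' x hx => ?_⟩
      · simp only [hf]
        split_ifs with hc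
        · exact hpos _ _ hc
        · exact one_pos
      · have := hp (x', x)
        simpa only [hf, if_pos hx] using this
  obtain ⟨c, hc, hle⟩ := this
  refine lt_of_lt_of_le (b := (c : EReal)) (by exact_mod_cast hc) ?_
  exact le_iInf fun x' => le_iInf fun x => le_iInf fun hx => by exact_mod_cast hle x' x hx

lemma rateIntegral_add_neg_of_lt_xi {lam : ℝ} (hlam : (lam : EReal) < xi σ F) (hx : x ≠ x') :
    rateIntegral σ F x' x + lam * permOrder σ < 0 := by
  have h : (lam : EReal) < ((-(1 / (permOrder σ : ℝ)) * rateIntegral σ F x' x : ℝ) : EReal) :=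
    hlam.trans_le (iInf_le_of_le x' (iInf_le_of_le x (iInf_le _ hx)))
  rw [EReal.coe_lt_coe_iff] at h
  have hM : (0 : ℝ) < permOrder σ := by exact_mod_cast permOrder_pos σ
  have e : -(1 / (permOrder σ : ℝ)) * rateIntegral σ F x' x * permOrder σ
      = -rateIntegral σ F x' x := by field_simp
  nlinarith [mul_lt_mul_of_pos_right h hM]

lemma exists_isLargeWindow (w0 : Fin m → ℝ) {lam : ℝ}
    (h : ∀ x' x : Fin m, x ≠ x' → rateIntegral σ F x' x + lam * permOrder σ < 0) :
    ∃ α, IsLargeWindow σ F w0 lam α := by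
  have : ∀ᶠ α : ℝ in atTop, IsLargeWindow σ F w0 lam α := by
    refine (eventually_gt_atTop 0).and ?_
    simp only [eventually_all]
    intro x' x hx
    have ht : Tendsto (fun α : ℝ => rateIntegral σ F x' x + lam * permOrder σ
      + Real.exp (-α) * (∑ n ∈ lagSet σ F x' x, 1 / (permOrder σ : ℝ) * klDiv σ F x' x n
          + 2 * logitBound F w0)) atTop (𝓝 (rateIntegral σ F x' x + lam * permOrder σ
      + 0 * (∑ n ∈ lagSet σ F x' x, 1 / (permOrder σ : ℝ) * klDiv σ F x' x n
          + 2 * logitBound F w0))) :=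
      (((Real.tendsto_exp_atBot.comp tendsto_neg_atTop_atBot)).mul_const _).const_add _
    refine ht.eventually_lt_const ?_
    simpa using h x' x hx
  exact this.exists

/-- The change of variables `τ = -c e^{-s}`. -/
lemma integral_logMGF_exp (hF : ∀ s x, 0 < F s x) (h1 : ∀ x, ∑ s, F s x = 1) (n : ℕ)
    {c : ℝ} (hc : 0 < c) (α : ℝ) :
    ∫ s in (0 : ℝ)..α, logMGF σ F x' x n (-c * Real.exp (-s))
      = ∫ τ in (-c * Real.exp (-α))..(-c), logMGF σ F x' x n τ / τ := by
  have hf : ∀ s ∈ Set.uIcc (0 : ℝ) α,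
      HasDerivAt (fun s => -c * Real.exp (-s)) (c * Real.exp (-s)) s := by
    intro s _
    exact (((hasDerivAt_neg s).exp).const_mul (-c)).congr_deriv (by ring)
  have := intervalIntegral.integral_comp_mul_deriv' (a := 0) (b := α)
    (f := fun s => -c * Real.exp (-s)) (f' := fun s => c * Real.exp (-s))
    (g := fun τ => logMGF σ F x' x n τ / τ) hf (by fun_prop) ?_
  · rw [intervalIntegral.integral_symm (-c)]
    simp only [neg_zero, Real.exp_zero, mul_one] at this
    rw [← this, ← intervalIntegral.integral_neg]
    congr 1
    ext s
    have : c * Real.exp (-s) ≠ 0 := (mul_pos hc (Real.exp_pos _)).ne'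
    simp only [Function.comp]
    field_simp
  · refine (continuous_logMGF hF h1 n).continuousOn.div continuousOn_id ?_
    rintro _ ⟨s, _, rfl⟩
    have := mul_pos hc (Real.exp_pos (-s))
    linarith

/-- The window stops at `τ = -c e^{-α}` instead of `0`. On the missing piece, dividing Jensen's
inequality by `τ < 0` gives `Λ_n(τ)/τ ≤ d_n`. -/
lemma integral_logMGF_exp_le (hF : ∀ s x, 0 < F s x) (h1 : ∀ x, ∑ s, F s x = 1) (n : ℕ)
    {c : ℝ} (hc : 0 < c) (α : ℝ) :
    ∫ s in (0 : ℝ)..α, logMGF σ F x' x n (-c * Real.exp (-s))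
      ≤ (∫ τ in (0 : ℝ)..(-c), logMGF σ F x' x n τ / τ)
        + Real.exp (-α) * (c * klDiv σ F x' x n) := by
  rw [integral_logMGF_exp hF h1 n hc, ← intervalIntegral.integral_add_adjacent_intervals
    (intervalIntegrable_logMGF_div hF h1 n (-c * Real.exp (-α)) 0)
    (intervalIntegrable_logMGF_div hF h1 n 0 (-c)), add_comm]
  have hpos := mul_pos hc (Real.exp_pos (-α))
  have : ∫ τ in (-c * Real.exp (-α))..0, logMGF σ F x' x n τ / τ
      ≤ ∫ τ in (-c * Real.exp (-α))..0, klDiv σ F x' x n := by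
    refine intervalIntegral.integral_mono_on_of_le_Ioo (by linarith)
      (intervalIntegrable_logMGF_div hF h1 n _ _) (by simp) ?_
    intro τ hτ
    rw [div_le_iff_of_neg hτ.2]
    linarith [mul_klDiv_le_logMGF (σ := σ) (x' := x') (x := x) hF h1 n τ]
  rw [intervalIntegral.integral_const, smul_eq_mul] at this
  linarith

lemma sum_integral_logMGF_exp_le (hF : ∀ s x, 0 < F s x) (h1 : ∀ x, ∑ s, F s x = 1) (α : ℝ) :
    ∑ n ∈ Finset.range (permOrder σ),
        ∫ s in (0 : ℝ)..α, logMGF σ F x' x n (-(1 / (permOrder σ : ℝ)) * Real.exp (-s))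
      ≤ rateIntegral σ F x' x + Real.exp (-α)
        * ∑ n ∈ lagSet σ F x' x, 1 / (permOrder σ : ℝ) * klDiv σ F x' x n := by
  rw [← Finset.sum_subset lagSet_subset, rateIntegral, Finset.mul_sum, ← Finset.sum_add_distrib]
  · exact Finset.sum_le_sum fun n _ => integral_logMGF_exp_le hF h1 n (inv_permOrder_pos σ) α
  · intro n hn hn'
    simp [logMGF_eq_zero hF h1 hn hn']

lemma abs_exp_neg_sub_le {s t : ℝ} (hs : 0 ≤ s) (ht : 0 ≤ t) :
    |Real.exp (-s) - Real.exp (-t)| ≤ |s - t| := by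
  wlog hst : s ≤ t generalizing s t
  · rw [abs_sub_comm, abs_sub_comm s]
    exact this ht hs (le_of_not_ge hst)
  rw [abs_of_nonneg (sub_nonneg.2 (Real.exp_le_exp.2 (by linarith))), abs_sub_comm,
    abs_of_nonneg (sub_nonneg.2 hst)]
  have e : Real.exp (-t) = Real.exp (-s) * Real.exp (s - t) := by
    rw [← Real.exp_add]; congr 1; ring
  have h1 := Real.add_one_le_exp (s - t)
  have h2 : Real.exp (-s) ≤ 1 := Real.exp_le_one_iff.2 (by linarith)
  have h3 := Real.exp_pos (-s)
  rw [e]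
  nlinarith

/-- The exponent of the Chernoff bound over a window of length `⌈α / δ⌉`. -/
lemma exists_sum_logMGF_le (hF : ∀ s x, 0 < F s x) (h1 : ∀ x, ∑ s, F s x = 1) (x' x : Fin m)
    {α : ℝ} (hα : 0 < α) :
    ∃ C : ℝ, ∀ δ : ℝ, 0 < δ → δ ≤ 1 / 2 →
      ∑ n ∈ Finset.range ⌈α / δ⌉₊,
          logMGF σ F x' x n (-(1 / (permOrder σ : ℝ)) * (1 - δ) ^ n)
        ≤ 1 / (permOrder σ * δ) * (rateIntegral σ F x' x + Real.exp (-α)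
            * ∑ n ∈ lagSet σ F x' x, 1 / (permOrder σ : ℝ) * klDiv σ F x' x n) + C := by
  set M := permOrder σ with hMdef
  set W := logitBound F (0 : Fin m → ℝ)
  have hW : 0 ≤ W := logitBound_nonneg _
  have hM : (0 : ℝ) < M := by exact_mod_cast permOrder_pos σ
  have hc := inv_permOrder_pos σ
  have hc1 := inv_permOrder_le_one σ
  -- With mesh `β = -log (1 - δ)` one has `(1 - δ)^n = e^{-βn}`, so the exponent is exactly the sum
  -- of the values `h n (β * n)`.
  set h : ℕ → ℝ → ℝ := fun n s => logMGF σ F x' x n (-(1 / (M : ℝ)) * Real.exp (-s)) with hh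
  have hmem : ∀ s : ℝ, 0 ≤ s → 0 < 1 / (M : ℝ) * Real.exp (-s) ∧
      1 / (M : ℝ) * Real.exp (-s) ≤ 1 := fun s hs =>
    ⟨mul_pos hc (Real.exp_pos _),
      mul_le_one₀ hc1 (Real.exp_pos _).le (Real.exp_le_one_iff.2 (by linarith))⟩
  have hper : ∀ n, h (n + M) = h n := fun n => by
    ext s; simp only [hh, hMdef, logMGF_add_permOrder]
  have hcont : ∀ n, Continuous (h n) := fun n =>
    (continuous_logMGF hF h1 n).comp (by fun_prop)
  have hlip : ∀ n s t, 0 ≤ s → 0 ≤ t → |h n s - h n t| ≤ 2 * W * |s - t| := by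
    intro n s t hs ht
    refine (abs_logMGF_sub_le hF h1 0 n _ _).trans ?_
    refine mul_le_mul_of_nonneg_left ?_ (by positivity)
    rw [← mul_sub, abs_mul, abs_neg, abs_of_pos hc]
    exact (mul_le_of_le_one_left (abs_nonneg _) hc1).trans (abs_exp_neg_sub_le hs ht)
  have hneg : ∀ n s, 0 ≤ s → h n s ≤ 0 := by
    intro n s hs
    obtain ⟨h2, h3⟩ := hmem s hs
    exact logMGF_nonpos hF h1 n (by linarith) (by linarith)
  have hbd : ∀ n s, 0 ≤ s → -(2 * W) ≤ h n s := by
    intro n s hs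
    obtain ⟨h2, h3⟩ := hmem s hs
    have h4 := abs_logMGF_le (σ := σ) (x' := x') (x := x) hF h1 0 n
      (-(1 / (M : ℝ)) * Real.exp (-s))
    have h5 : |-(1 / (M : ℝ)) * Real.exp (-s)| ≤ 1 := by
      rw [abs_le]; constructor <;> linarith
    have h6 := neg_abs_le (h n s)
    have h7 : |h n s| ≤ 2 * W := h4.trans (mul_le_of_le_one_right (by positivity) h5)
    linarith
  set A := ∑ n ∈ Finset.range M, ∫ s in (0 : ℝ)..α, h n s with hA
  have hAneg : A ≤ 0 := Finset.sum_nonpos fun n _ => by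
    have := intervalIntegral.integral_mono_on (μ := volume) hα.le ((hcont n).intervalIntegrable 0 α)
      (intervalIntegrable_const (c := (0 : ℝ))) fun s hs => hneg n s hs.1
    simpa using this
  have hAle := sum_integral_logMGF_exp_le (σ := σ) (x' := x') (x := x) hF h1 α
  -- The three terms pay for replacing `β` by `δ` in `A / (M * β)`, for the boundary of the Riemann
  -- sum, and for its Lipschitz error, where `K * β ≤ 2 * α + 1`.
  refine ⟨-A / M + M * (2 * W) + 2 * W * M * (2 * α + 1), fun δ hδ hδ2 => ?_⟩
  set K := ⌈α / δ⌉₊ with hK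
  have hKge : α ≤ δ * K := by
    have := Nat.le_ceil (α / δ)
    rw [div_le_iff₀ hδ] at this
    linarith
  have hKle : K * δ ≤ α + δ := by
    have := (Nat.ceil_lt_add_one (div_pos hα hδ).le).le
    calc (K : ℝ) * δ ≤ (α / δ + 1) * δ := by gcongr
      _ = α + δ := by field_simp
  set β := -Real.log (1 - δ) with hβ
  have h1δ : 0 < 1 - δ := by linarith
  have hβδ : δ ≤ β := by
    have := Real.log_le_sub_one_of_pos h1δ
    linarith
  have hβδ' : β * (1 - δ) ≤ δ := by
    have h2 := Real.one_sub_inv_le_log_of_pos h1δ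
    have h3 : β ≤ (1 - δ)⁻¹ - 1 := by linarith
    calc β * (1 - δ) ≤ ((1 - δ)⁻¹ - 1) * (1 - δ) := by gcongr
      _ = δ := by field_simp; ring
  have hβ0 : 0 < β := hδ.trans_le hβδ
  have hβ2 : β ≤ 2 * δ := by nlinarith
  have hexp : ∀ n : ℕ, h n (β * n) = logMGF σ F x' x n (-(1 / (M : ℝ)) * (1 - δ) ^ n) := by
    intro n
    simp only [hh]
    congr 2
    rw [hβ, neg_mul, neg_neg, mul_comm, Real.exp_nat_mul, Real.exp_log h1δ]
  have key := periodic_riemann_sum_le hper hcont hlip hneg hbd (by positivity) (by positivity)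
    hβ0 hα.le (K := K) (hKge.trans (by gcongr))
  simp only [hexp] at key
  set Z := ∑ n ∈ Finset.range K, logMGF σ F x' x n (-(1 / (M : ℝ)) * (1 - δ) ^ n)
  have hKβ : K * β ≤ 2 * α + 1 := by
    calc (K : ℝ) * β ≤ K * (2 * δ) := by gcongr
      _ = 2 * (K * δ) := by ring
      _ ≤ 2 * (α + δ) := by gcongr
      _ ≤ 2 * α + 1 := by linarith
  have hMβ : 0 < M * β := mul_pos hM hβ0
  have h2 : Z ≤ A / (M * β) + M * (2 * W) + 2 * W * M * (2 * α + 1) := by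
    have h3 : M * β * (A / (M * β) + M * (2 * W) + 2 * W * M * (K * β))
        = A + M * (2 * W * (β * M)) + K * (2 * W * (M * β) ^ 2) := by
      field_simp
    rw [← h3] at key
    have h4 := le_of_mul_le_mul_left key hMβ
    have h5 : 2 * W * M * (K * β) ≤ 2 * W * M * (2 * α + 1) := by gcongr
    linarith
  -- Here `A ≤ 0`, so what is needed is the upper bound `β * (1 - δ) ≤ δ`.
  have h3 : A / (M * β) ≤ 1 / (M * δ) * A + -A / M := by
    have e : 1 / (M * δ) * A + -A / M = A * (1 - δ) / (M * δ) := by field_simp; ring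
    rw [e, div_le_div_iff₀ hMβ (mul_pos hM hδ)]
    have : 0 ≤ -A * M := mul_nonneg (by linarith) hM.le
    nlinarith
  have h4 : 1 / (M * δ) * A ≤ 1 / (M * δ) * (rateIntegral σ F x' x + Real.exp (-α)
            * ∑ n ∈ lagSet σ F x' x, 1 / (M : ℝ) * klDiv σ F x' x n) :=
    mul_le_mul_of_nonneg_left hAle (by positivity)
  linarith

end rate

/-! ### The filter as a discounted sum of log-likelihoods -/

section filter

variable {m r S : ℕ}

/-- The filter on the recurrent states, where it is finite. -/
def recLogit (σ : Equiv.Perm (Fin m)) (F : Matrix (Fin S) (Fin m) ℝ) (δ : ℝ)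
    (w0 : Fin m → ℝ) (y : ℕ → Fin S) : ℕ → Fin m → ℝ
  | 0 => w0
  | k + 1 => fun x =>
      (1 - δ) * recLogit σ F δ w0 y k (σ⁻¹ x) + δ * Real.log (F (y (k + 1)) x)

lemma alf_inl (σ : Equiv.Perm (Fin m)) {E : Matrix (Fin S) (State m r) ℝ}
    (hE : ∀ s x, 0 < recEmission E s x) (δ : ℝ) (w0 : Fin m → ℝ) (y : ℕ → Fin S) (k : ℕ)
    (x : Fin m) :
    alf σ E δ w0 y k (Sum.inl x) = (recLogit σ (recEmission E) δ w0 y k x : ℝ) := by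
  induction k generalizing x with
  | zero => rfl
  | succ k ih =>
    have hpos : 0 < E (y (k + 1)) (Sum.inl x) := hE (y (k + 1)) x
    have hσ : σ (σ⁻¹ x) = x := σ.apply_symm_apply x
    simp only [alf, alfStep, recLogit, Fintype.sum_sum_type, fromBlocks_apply₁₁,
      fromBlocks_apply₁₂, Matrix.zero_apply, EReal.coe_zero, zero_mul, Finset.sum_const_zero,
      add_zero, ih]
    rw [Finset.sum_eq_single (σ⁻¹ x)]
    · rw [mulVec_single_one]
      simp only [permMat, of_apply, col_apply, transpose_apply, recEmission,
        hσ, if_true, EReal.coe_one, one_mul]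
      rw [ENNReal.log_ofReal_of_pos hpos]
      push_cast
      rfl
    · intro j _ hj
      have : x ≠ σ j := fun h => hj (by rw [h]; exact (σ.symm_apply_apply j).symm)
      simp [permMat, this]
    · simp

/-- In `EReal`, `⊥` plus anything is `⊥`, and `1 - δ > 0` preserves `⊥`: a transient state never
recovers, whatever its emissions. -/
lemma alf_inr (σ : Equiv.Perm (Fin m)) (E : Matrix (Fin S) (State m r) ℝ) {δ : ℝ} (hδ : δ < 1)
    (w0 : Fin m → ℝ) (y : ℕ → Fin S) (k : ℕ) (z : Fin r) :
    alf σ E δ w0 y k (Sum.inr z) = ⊥ := by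
  induction k generalizing z with
  | zero => rfl
  | succ k ih =>
    have h1 : (((1 - δ : ℝ) : EReal)) * ⊥ = ⊥ := EReal.coe_mul_bot_of_pos (by linarith)
    simp only [alf, alfStep, Fintype.sum_sum_type, fromBlocks_apply₂₁,
      fromBlocks_apply₂₂, Matrix.zero_apply, EReal.coe_zero, zero_mul, Finset.sum_const_zero,
      zero_add, ih, h1]
    rw [Finset.sum_eq_single z]
    · simp
    · intro j _ hj
      simp [Matrix.one_apply_ne hj.symm]
    · simp

lemma exists_recLogit_le (σ : Equiv.Perm (Fin m)) {E : Matrix (Fin S) (State m r) ℝ}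
    (hE : ∀ s x, 0 < recEmission E s x) {δ : ℝ} (hδ : δ < 1) (w0 : Fin m → ℝ) (y : ℕ → Fin S)
    (k : ℕ) {x' : Fin m} (h : argmax (alf σ E δ w0 y k) ≠ {Sum.inl x'}) :
    ∃ x, x ≠ x' ∧ recLogit σ (recEmission E) δ w0 y k x'
      ≤ recLogit σ (recEmission E) δ w0 y k x := by
  by_contra! hc
  refine h (Set.eq_singleton_iff_unique_mem.2 ⟨?_, ?_⟩)
  · rintro (x | z)
    · rw [alf_inl σ hE, alf_inl σ hE, EReal.coe_le_coe_iff]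
      by_cases hx : x = x'
      · rw [hx]
      · exact (hc x hx).le
    · rw [alf_inr σ E hδ]
      exact bot_le
  · rintro (x | z) hx
    · have := hx (Sum.inl x')
      rw [alf_inl σ hE, alf_inl σ hE, EReal.coe_le_coe_iff] at this
      by_contra hne
      exact absurd this (not_le.2 (hc x fun h => hne (by rw [h])))
    · have := hx (Sum.inl x')
      rw [alf_inl σ hE, alf_inr σ E hδ] at this
      exact absurd this (by simp)

/-- Each update is a convex combination of quantities bounded by `W`. -/
lemma abs_recLogit_le (σ : Equiv.Perm (Fin m)) (F : Matrix (Fin S) (Fin m) ℝ) {δ : ℝ}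
    (hδ : 0 ≤ δ) (hδ1 : δ ≤ 1) (w0 : Fin m → ℝ) (y : ℕ → Fin S) (k : ℕ) (x : Fin m) :
    |recLogit σ F δ w0 y k x| ≤ logitBound F w0 := by
  induction k generalizing x with
  | zero => exact abs_init_le_logitBound w0 x
  | succ k ih =>
    simp only [recLogit]
    refine (abs_add_le _ _).trans ?_
    rw [abs_mul, abs_mul, abs_of_nonneg hδ, abs_of_nonneg (sub_nonneg.2 hδ1)]
    calc _ ≤ (1 - δ) * logitBound F w0 + δ * logitBound F w0 :=
          add_le_add (mul_le_mul_of_nonneg_left (ih _) (sub_nonneg.2 hδ1))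
            (mul_le_mul_of_nonneg_left (abs_log_le_logitBound w0 _ _) hδ)
      _ = _ := by ring

/-- The recursion is unrolled for `K` steps only, because the state is known to follow `σ` only
within the window; the rest is a remainder of weight `(1 - δ)^K`. -/
lemma recLogit_eq_window (σ : Equiv.Perm (Fin m)) (F : Matrix (Fin S) (Fin m) ℝ) (δ : ℝ)
    (w0 : Fin m → ℝ) (y : ℕ → Fin S) (K k : ℕ) (hK : K ≤ k) (x : Fin m) :
    recLogit σ F δ w0 y k x
      = δ * ∑ n ∈ Finset.range K, (1 - δ) ^ n * Real.log (F (y (k - n)) ((σ ^ (-(n : ℤ))) x))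
        + (1 - δ) ^ K * recLogit σ F δ w0 y (k - K) ((σ ^ (-(K : ℤ))) x) := by
  induction K with
  | zero => simp
  | succ K ih =>
    rw [ih (by omega)]
    obtain ⟨l, hl⟩ : ∃ l, k - K = l + 1 := ⟨k - K - 1, by omega⟩
    have hl' : k - (K + 1) = l := by omega
    rw [Finset.sum_range_succ, hl, hl']
    simp only [recLogit]
    have e : σ⁻¹ ((σ ^ (-(K : ℤ))) x) = (σ ^ (-((K + 1 : ℕ) : ℤ))) x := by
      rw [← Equiv.Perm.mul_apply, ← _root_.zpow_neg_one, ← _root_.zpow_add]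
      congr 2
      push_cast
      ring
    rw [e]
    ring

/-- If the filter does not separate `x'` from `x`, then the log-likelihood ratios over the last
`K` observations have a small discounted sum. -/
lemma window_sum_le_of_recLogit_le (σ : Equiv.Perm (Fin m)) {F : Matrix (Fin S) (Fin m) ℝ}
    (hF : ∀ s x, 0 < F s x) {δ : ℝ} (hδ : 0 < δ) (hδ1 : δ < 1) (w0 : Fin m → ℝ) (y : ℕ → Fin S)
    {K k : ℕ} (hK : K ≤ k) {x' x : Fin m}
    (h : recLogit σ F δ w0 y k x' ≤ recLogit σ F δ w0 y k x) :
    ∑ n ∈ Finset.range K, (1 - δ) ^ n * logRatio σ F x' x n (y (k - n))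
      ≤ (1 - δ) ^ K * (2 * logitBound F w0) / δ := by
  rw [recLogit_eq_window σ F δ w0 y K k hK x', recLogit_eq_window σ F δ w0 y K k hK x] at h
  have e : ∑ n ∈ Finset.range K, (1 - δ) ^ n * logRatio σ F x' x n (y (k - n))
      = ∑ n ∈ Finset.range K, (1 - δ) ^ n * Real.log (F (y (k - n)) ((σ ^ (-(n : ℤ))) x'))
        - ∑ n ∈ Finset.range K, (1 - δ) ^ n * Real.log (F (y (k - n)) ((σ ^ (-(n : ℤ))) x)) := by
    rw [← Finset.sum_sub_distrib]
    refine Finset.sum_congr rfl fun n _ => ?_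
    rw [logRatio, Real.log_div (hF _ _).ne' (hF _ _).ne', mul_sub]
  rw [e, le_div_iff₀ hδ]
  have h1 := abs_le.1 (abs_recLogit_le σ F hδ.le hδ1.le w0 y (k - K) ((σ ^ (-(K : ℤ))) x'))
  have h2 := abs_le.1 (abs_recLogit_le σ F hδ.le hδ1.le w0 y (k - K) ((σ ^ (-(K : ℤ))) x))
  have h3 : 0 ≤ (1 - δ) ^ K := pow_nonneg (by linarith) K
  have h4 := mul_le_mul_of_nonneg_left h2.2 h3
  have h5 := mul_le_mul_of_nonneg_left h1.1 h3
  linarith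

end filter

/-! ### Events determined by the past -/

section history

variable {Ω : Type*} {m r S : ℕ} {X : ℕ → Ω → State m r} {Y : ℕ → Ω → Fin S}

/-- Membership in `A` depends only on the states up to time `n` and the observations at the
times `1, …, n`. -/
def IsHistorySet (X : ℕ → Ω → State m r) (Y : ℕ → Ω → Fin S) (n : ℕ) (A : Set Ω) : Prop :=
  ∀ ω ω', (∀ k ≤ n, X k ω = X k ω') → (∀ k, 1 ≤ k → k ≤ n → Y k ω = Y k ω') → ω ∈ A → ω' ∈ A

/-- The states and observations up to time `n`. -/
def history (X : ℕ → Ω → State m r) (Y : ℕ → Ω → Fin S) (n : ℕ) (ω : Ω) :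
    (Fin (n + 1) → State m r) × (Fin n → Fin S) :=
  (fun i => X i ω, fun i => Y (i + 1) ω)

lemma history_eq_iff {n : ℕ} {ω ω' : Ω} : history X Y n ω = history X Y n ω' ↔
    (∀ k ≤ n, X k ω = X k ω') ∧ ∀ k, 1 ≤ k → k ≤ n → Y k ω = Y k ω' := by
  simp only [history, Prod.mk.injEq, funext_iff]
  constructor
  · rintro ⟨h1, h2⟩
    refine ⟨fun k hk => h1 ⟨k, by omega⟩, fun k hk hk' => ?_⟩
    have := h2 ⟨k - 1, by omega⟩
    simpa only [Nat.sub_add_cancel hk] using this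
  · rintro ⟨h1, h2⟩
    exact ⟨fun i => h1 i (by omega), fun i => h2 _ (by omega) (by omega)⟩

lemma isHistorySet_inter {n : ℕ} {A B : Set Ω} (hA : IsHistorySet X Y n A)
    (hB : IsHistorySet X Y n B) : IsHistorySet X Y n (A ∩ B) :=
  fun ω ω' h1 h2 h => ⟨hA ω ω' h1 h2 h.1, hB ω ω' h1 h2 h.2⟩

lemma isHistorySet_state (n : ℕ) (b : State m r) : IsHistorySet X Y n {ω | X n ω = b} :=
  fun _ _ h1 _ h => (h1 n le_rfl).symm.trans h

end history

/-! ### The Markov property and Chernoff's bound along a path -/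

section hmm

variable {Ω : Type*} [MeasurableSpace Ω] {μ : Measure Ω} {m r S : ℕ}
  {X : ℕ → Ω → State m r} {Y : ℕ → Ω → Fin S} {π₀ : State m r → ℝ}
  {T : Matrix (State m r) (State m r) ℝ} {E : Matrix (Fin S) (State m r) ℝ}

lemma measureReal_eq_sum_preimage {ι : Type*} [Fintype ι] [IsProbabilityMeasure μ] {Z : Ω → ι}
    (hZ : ∀ c, MeasurableSet (Z ⁻¹' {c})) {A : Set Ω} (hA : MeasurableSet A) :
    μ.real A = ∑ c, μ.real (A ∩ Z ⁻¹' {c}) := by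
  have : A = ⋃ c ∈ Finset.univ, A ∩ Z ⁻¹' {c} := by
    ext ω; simp
  conv_lhs => rw [this]
  refine measureReal_biUnion_finset ?_ fun c _ => hA.inter (hZ c)
  intro c _ d _ hcd
  refine Set.disjoint_left.2 ?_
  rintro ω ⟨_, h1⟩ ⟨_, h2⟩
  exact hcd (h1.symm.trans h2)

lemma IsHMM.measurableSet_state (h : IsHMM μ X Y π₀ T E) (k : ℕ) (a : State m r) :
    MeasurableSet {ω | X k ω = a} := by
  have : MeasurableSet ({a} : Set (State m r)) := by
    rcases a with x | z
    · simpa using (measurableSet_singleton x).inl_image (β := Fin r)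
    · simpa using (measurableSet_singleton z).inr_image (α := Fin m)
  exact h.meas_state k this

lemma IsHMM.measurableSet_obs (h : IsHMM μ X Y π₀ T E) (k : ℕ) (s : Fin S) :
    MeasurableSet {ω | Y k ω = s} :=
  h.meas_obs k (measurableSet_singleton s)

lemma IsHMM.measurableSet_history (h : IsHMM μ X Y π₀ T E) (n : ℕ)
    (c : (Fin (n + 1) → State m r) × (Fin n → Fin S)) :
    MeasurableSet (history X Y n ⁻¹' {c}) := by
  have : history X Y n ⁻¹' {c}
      = (⋂ i : Fin (n + 1), {ω | X i ω = c.1 i}) ∩ ⋂ i : Fin n, {ω | Y (i + 1) ω = c.2 i} := by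
    ext ω
    simp [history, Prod.ext_iff, funext_iff]
  rw [this]
  exact (MeasurableSet.iInter fun i => h.measurableSet_state _ _).inter
    (MeasurableSet.iInter fun i => h.measurableSet_obs _ _)

lemma IsHMM.measurableSet_of_isHistorySet (h : IsHMM μ X Y π₀ T E) {n : ℕ} {A : Set Ω}
    (hA : IsHistorySet X Y n A) : MeasurableSet A := by
  have : A = ⋃ c ∈ history X Y n '' A, history X Y n ⁻¹' {c} := by
    ext ω
    simp only [Set.mem_iUnion, Set.mem_preimage, Set.mem_singleton_iff, exists_prop,
      exists_eq_right']
    refine ⟨fun hω => ⟨ω, hω, rfl⟩, ?_⟩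
    rintro ⟨ω', hω', he⟩
    obtain ⟨h1, h2⟩ := history_eq_iff.1 he
    exact hA ω' ω h1 h2 hω'
  rw [this]
  exact (Set.toFinite _).measurableSet_biUnion fun c _ => h.measurableSet_history n c

/-- The Markov property, extracted from the joint law by splitting `A` into its finitely many
histories. -/
lemma IsHMM.measureReal_inter_next (h : IsHMM μ X Y π₀ T E) {n : ℕ} {A : Set Ω}
    (hA : IsHistorySet X Y n A) {b : State m r} (hb : ∀ ω ∈ A, X n ω = b) (a : State m r)
    (s : Fin S) :
    μ.real (A ∩ {ω | X (n + 1) ω = a ∧ Y (n + 1) ω = s}) = T a b * E s a * μ.real A := by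
  have := h.prob
  have hAm := h.measurableSet_of_isHistorySet hA
  have hN : MeasurableSet {ω | X (n + 1) ω = a ∧ Y (n + 1) ω = s} :=
    (h.measurableSet_state _ _).inter (h.measurableSet_obs _ _)
  rw [measureReal_eq_sum_preimage (h.measurableSet_history n) (hAm.inter hN),
    measureReal_eq_sum_preimage (h.measurableSet_history n) hAm, Finset.mul_sum]
  refine Finset.sum_congr rfl fun c _ => ?_
  rcases Set.eq_empty_or_nonempty (A ∩ history X Y n ⁻¹' {c}) with he | ⟨ω₀, hω₀, hc⟩
  · rw [he, Set.inter_right_comm, he]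
    simp
  · rw [Set.mem_preimage, Set.mem_singleton_iff] at hc
    have e1 : A ∩ history X Y n ⁻¹' {c}
        = {ω | (∀ k ≤ n, X k ω = X k ω₀) ∧ ∀ k, 1 ≤ k → k ≤ n → Y k ω = Y k ω₀} := by
      ext ω
      simp only [Set.mem_inter_iff, Set.mem_preimage, Set.mem_singleton_iff, Set.mem_ofPred_eq,
        ← hc, ← history_eq_iff]
      refine ⟨fun h => h.2, fun hω => ⟨?_, hω⟩⟩
      obtain ⟨h1, h2⟩ := history_eq_iff.1 hω.symm
      exact hA ω₀ ω h1 h2 hω₀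
    -- Appending `a` and `s` at time `n + 1` to the reference path `ω₀` gives a cylinder to which
    -- `joint_law` applies again.
    have e2 : A ∩ {ω | X (n + 1) ω = a ∧ Y (n + 1) ω = s} ∩ history X Y n ⁻¹' {c}
        = {ω | (∀ k ≤ n + 1, X k ω = Function.update (fun k => X k ω₀) (n + 1) a k) ∧
            ∀ k, 1 ≤ k → k ≤ n + 1 →
              Y k ω = Function.update (fun k => Y k ω₀) (n + 1) s k} := by
      rw [Set.inter_right_comm, e1]
      ext ω
      simp only [Set.mem_inter_iff, Set.mem_ofPred_eq]
      constructor
      · rintro ⟨⟨h1, h2⟩, h3, h4⟩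
        refine ⟨fun k hk => ?_, fun k hk hk' => ?_⟩
        · rcases eq_or_ne k (n + 1) with rfl | hne
          · simpa using h3
          · rw [Function.update_of_ne hne]; exact h1 k (by omega)
        · rcases eq_or_ne k (n + 1) with rfl | hne
          · simpa using h4
          · rw [Function.update_of_ne hne]; exact h2 k hk (by omega)
      · rintro ⟨h1, h2⟩
        refine ⟨⟨fun k hk => ?_, fun k hk hk' => ?_⟩, ?_, ?_⟩
        · have := h1 k (by omega)
          rwa [Function.update_of_ne (by omega)] at this
        · have := h2 k hk (by omega)
          rwa [Function.update_of_ne (by omega)] at this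
        · simpa using h1 (n + 1) le_rfl
        · simpa using h2 (n + 1) (by omega) le_rfl
    rw [e1, e2, h.joint_law, h.joint_law, Finset.prod_range_succ, Function.update_self,
      Function.update_self, Function.update_of_ne (by omega), Function.update_of_ne (by omega),
      hb ω₀ hω₀]
    have : ∏ k ∈ Finset.range n, T (Function.update (fun k => X k ω₀) (n + 1) a (k + 1))
          (Function.update (fun k => X k ω₀) (n + 1) a k)
          * E (Function.update (fun k => Y k ω₀) (n + 1) s (k + 1))
            (Function.update (fun k => X k ω₀) (n + 1) a (k + 1))
        = ∏ k ∈ Finset.range n, T (X (k + 1) ω₀) (X k ω₀) * E (Y (k + 1) ω₀) (X (k + 1) ω₀) := by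
      refine Finset.prod_congr rfl fun k hk => ?_
      have := Finset.mem_range.1 hk
      rw [Function.update_of_ne (by omega), Function.update_of_ne (by omega),
        Function.update_of_ne (by omega)]
    rw [this]
    ring

/-- Transition probabilities are simply bounded by `1`. The bounds below thus concern joint events,
and no conditioning on the state path is needed. -/
lemma IsHMM.measureReal_inter_next_le (h : IsHMM μ X Y π₀ T E) (hE : ∀ s a, 0 ≤ E s a)
    (hT : ∀ a b, T a b ≤ 1) {n : ℕ} {A : Set Ω} (hA : IsHistorySet X Y n A) (a : State m r)
    (s : Fin S) :
    μ.real (A ∩ {ω | X (n + 1) ω = a ∧ Y (n + 1) ω = s}) ≤ E s a * μ.real A := by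
  have := h.prob
  have hAm := h.measurableSet_of_isHistorySet hA
  have hN : MeasurableSet {ω | X (n + 1) ω = a ∧ Y (n + 1) ω = s} :=
    (h.measurableSet_state _ _).inter (h.measurableSet_obs _ _)
  rw [measureReal_eq_sum_preimage (h.measurableSet_state n) (hAm.inter hN),
    measureReal_eq_sum_preimage (h.measurableSet_state n) hAm, Finset.mul_sum]
  refine Finset.sum_le_sum fun b _ => ?_
  rw [Set.inter_right_comm]
  have := h.measureReal_inter_next (isHistorySet_inter hA (isHistorySet_state n b))
    (b := b) (fun ω hω => hω.2) a s
  refine this.le.trans ?_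
  have h1 : 0 ≤ μ.real (A ∩ {ω | X n ω = b}) := measureReal_nonneg
  exact mul_le_mul_of_nonneg_right (mul_le_of_le_one_left (hE s a) (hT a b)) h1

lemma IsHMM.measureReal_transition (h : IsHMM μ X Y π₀ T E) (hE : ∀ a, ∑ s, E s a = 1)
    (n : ℕ) (a b : State m r) :
    μ.real {ω | X n ω = b ∧ X (n + 1) ω = a} = T a b * μ.real {ω | X n ω = b} := by
  have := h.prob
  have hm : MeasurableSet {ω | X n ω = b ∧ X (n + 1) ω = a} :=
    (h.measurableSet_state n b).inter (h.measurableSet_state (n + 1) a)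
  rw [measureReal_eq_sum_preimage (h.measurableSet_obs (n + 1)) hm]
  have : ∀ s, μ.real ({ω | X n ω = b ∧ X (n + 1) ω = a} ∩ Y (n + 1) ⁻¹' {s})
      = T a b * E s a * μ.real {ω | X n ω = b} := by
    intro s
    rw [← h.measureReal_inter_next (isHistorySet_state n b) (fun ω hω => hω) a s]
    congr 1
    ext ω
    simp [and_assoc]
  refine (Finset.sum_congr rfl fun s _ => this s).trans ?_
  rw [← Finset.sum_mul, ← Finset.mul_sum, hE, mul_one]

lemma IsHMM.measureReal_jump_le (h : IsHMM μ X Y π₀ T E) (hE : ∀ a, ∑ s, E s a = 1)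
    (f : State m r → State m r) {c : ℝ} (hc : ∀ b, 1 - T (f b) b ≤ c) (n : ℕ) :
    μ.real {ω | X (n + 1) ω ≠ f (X n ω)} ≤ c := by
  have := h.prob
  have hm : ∀ b, MeasurableSet {ω | X n ω = b ∧ X (n + 1) ω = f b} :=
    fun b => (h.measurableSet_state _ _).inter (h.measurableSet_state _ _)
  have hsub : {ω | X (n + 1) ω ≠ f (X n ω)}
      ⊆ ⋃ b ∈ Finset.univ, ({ω | X n ω = b} \ {ω | X n ω = b ∧ X (n + 1) ω = f b}) := by
    intro ω hω
    simp only [Finset.mem_univ, Set.iUnion_true, Set.mem_iUnion]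
    exact ⟨X n ω, rfl, fun h => hω h.2⟩
  have h1 : ∑ b, μ.real {ω | X n ω = b} = 1 := by
    have := measureReal_eq_sum_preimage (μ := μ) (h.measurableSet_state n) MeasurableSet.univ
    simp only [Set.univ_inter, probReal_univ] at this
    exact this.symm
  calc μ.real {ω | X (n + 1) ω ≠ f (X n ω)}
      ≤ μ.real (⋃ b ∈ Finset.univ,
          ({ω | X n ω = b} \ {ω | X n ω = b ∧ X (n + 1) ω = f b})) := measureReal_mono hsub (measure_ne_top _ _)
    _ ≤ ∑ b, μ.real ({ω | X n ω = b} \ {ω | X n ω = b ∧ X (n + 1) ω = f b}) :=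
        measureReal_biUnion_finset_le _ _
    _ = ∑ b, (1 - T (f b) b) * μ.real {ω | X n ω = b} := by
        refine Finset.sum_congr rfl fun b _ => ?_
        have hle : {ω | X n ω = b ∧ X (n + 1) ω = f b} ⊆ {ω | X n ω = b} := fun ω hω => hω.1
        rw [measureReal_sdiff hle (hm b), h.measureReal_transition hE]
        ring
    _ ≤ ∑ b, c * μ.real {ω | X n ω = b} :=
        Finset.sum_le_sum fun b _ => mul_le_mul_of_nonneg_right (hc b) measureReal_nonneg
    _ = c := by rw [← Finset.mul_sum, h1, mul_one]

/-- Chernoff's bound for a sum over the last `K` observations on the event that the last `K`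
states follow a given path. -/
lemma IsHMM.measureReal_window_le (h : IsHMM μ X Y π₀ T E) (hE : ∀ s a, 0 ≤ E s a)
    (hT : ∀ a b, T a b ≤ 1) (K k : ℕ) (hK : K ≤ k) (x : ℕ → State m r) (g : ℕ → Fin S → ℝ)
    (c : ℝ) :
    μ.real {ω | (∀ n < K, X (k - n) ω = x n) ∧ ∑ n ∈ Finset.range K, g n (Y (k - n) ω) ≤ c}
      ≤ Real.exp c * ∏ n ∈ Finset.range K, ∑ s, E s (x n) * Real.exp (-g n s) := by
  have := h.prob
  induction K generalizing k x g c with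
  | zero =>
    by_cases hc : 0 ≤ c
    · simpa using measureReal_le_one.trans (Real.one_le_exp hc)
    · simp [hc, Real.exp_nonneg]
  | succ K ih =>
    obtain ⟨l, rfl⟩ : ∃ l, k = l + 1 := ⟨k - 1, by omega⟩
    have hKl : K ≤ l := by omega
    -- The induction peels off the newest time: given that its observation is `s`, the older part of
    -- the sum has threshold `c - g 0 s`. The function `g` already contains the Chernoff parameter.
    set A : Fin S → Set Ω := fun s => {ω | (∀ n < K, X (l - n) ω = x (n + 1)) ∧
      ∑ n ∈ Finset.range K, g (n + 1) (Y (l - n) ω) ≤ c - g 0 s} with hA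
    -- `K ≤ l` keeps the times `l - n` at least `1`, so `Y 0` never enters.
    have hAhist : ∀ s, IsHistorySet X Y l (A s) := by
      rintro s ω ω' h1 h2 ⟨h3, h4⟩
      refine ⟨fun n hn => (h1 _ (Nat.sub_le _ _)).symm.trans (h3 n hn), ?_⟩
      refine le_trans (le_of_eq (Finset.sum_congr rfl fun n hn => ?_)) h4
      have := Finset.mem_range.1 hn
      rw [h2 (l - n) (by omega) (by omega)]
    have hsub : {ω | (∀ n < K + 1, X (l + 1 - n) ω = x n) ∧
        ∑ n ∈ Finset.range (K + 1), g n (Y (l + 1 - n) ω) ≤ c}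
        ⊆ ⋃ s ∈ Finset.univ, (A s ∩ {ω | X (l + 1) ω = x 0 ∧ Y (l + 1) ω = s}) := by
      rintro ω ⟨h1, h2⟩
      simp only [Finset.mem_univ, Set.iUnion_true, Set.mem_iUnion]
      refine ⟨Y (l + 1) ω, ⟨fun n hn => ?_, ?_⟩, h1 0 (by omega), rfl⟩
      · have := h1 (n + 1) (by omega)
        rwa [Nat.add_sub_add_right] at this
      · rw [Finset.sum_range_succ'] at h2
        simp only [Nat.add_sub_add_right, Nat.sub_zero] at h2
        linarith
    calc _ ≤ _ := measureReal_mono hsub (measure_ne_top _ _)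
      _ ≤ ∑ s, μ.real (A s ∩ {ω | X (l + 1) ω = x 0 ∧ Y (l + 1) ω = s}) :=
          measureReal_biUnion_finset_le _ _
      _ ≤ ∑ s, E s (x 0) * (Real.exp (c - g 0 s)
            * ∏ n ∈ Finset.range K, ∑ s, E s (x (n + 1)) * Real.exp (-g (n + 1) s)) :=
          Finset.sum_le_sum fun s _ =>
            (h.measureReal_inter_next_le hE hT (hAhist s) (x 0) s).trans
              (mul_le_mul_of_nonneg_left
                (ih l hKl (fun n => x (n + 1)) (fun n => g (n + 1)) (c - g 0 s)) (hE _ _))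
      _ = _ := by
          rw [Finset.prod_range_succ', Finset.mul_sum, Finset.mul_sum]
          refine Finset.sum_congr rfl fun s _ => ?_
          rw [sub_eq_add_neg, Real.exp_add]
          ring

end hmm

/-! ### Deterministic dynamics and the size of the perturbation -/

section backbone

variable {m r : ℕ} {σ : Equiv.Perm (Fin m)} {D₁₂ : Matrix (Fin m) (Fin r) ℝ}
  {D₂₂ : Matrix (Fin r) (Fin r) ℝ} {D Q : Matrix (State m r) (State m r) ℝ}
  {f : State m r → State m r}

lemma next_inl (hD : D = fromBlocks (permMat σ) D₁₂ 0 D₂₂)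
    (hf : ∀ j, (fun a => D a j) = Pi.single (f j) 1) (x : Fin m) :
    f (Sum.inl x) = Sum.inl (σ x) := by
  have h := congrFun (hf (Sum.inl x)) (Sum.inl (σ x))
  by_contra hne
  rw [Pi.single_eq_of_ne' hne] at h
  simp [hD, permMat] at h

/-- As long as the backbone orbit is transient, powers of `D₂₂` track it; there is no return, since
recurrent states map to recurrent ones. -/
lemma pow_mulVec_single (hD : D = fromBlocks (permMat σ) D₁₂ 0 D₂₂)
    (hf : ∀ j, (fun a => D a j) = Pi.single (f j) 1) (n : ℕ) (b c : Fin r)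
    (h : f^[n] (Sum.inr b) = Sum.inr c) :
    (D₂₂ ^ n) *ᵥ Pi.single b 1 = Pi.single c 1 := by
  induction n generalizing c with
  | zero =>
    have : b = c := by simpa using h
    rw [this, pow_zero, one_mulVec]
  | succ n ih =>
    rw [Function.iterate_succ_apply'] at h
    rcases he : f^[n] (Sum.inr b) with x | d
    · rw [he, next_inl hD hf] at h
      exact absurd h (by simp)
    · rw [he] at h
      rw [pow_succ', ← mulVec_mulVec, ih d he, mulVec_single_one]
      ext a
      have h1 := congrFun (hf (Sum.inr d)) (Sum.inr a)
      rw [h] at h1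
      simp only [hD, fromBlocks_apply₂₂] at h1
      rw [col_apply, h1]
      by_cases hac : a = c
      · simp [hac]
      · rw [Pi.single_eq_of_ne hac, Pi.single_eq_of_ne (by simpa using hac)]

lemma iterate_inl (hD : D = fromBlocks (permMat σ) D₁₂ 0 D₂₂)
    (hf : ∀ j, (fun a => D a j) = Pi.single (f j) 1) (n : ℕ) (x : Fin m) :
    f^[n] (Sum.inl x) = Sum.inl ((σ ^ n) x) := by
  induction n with
  | zero => rfl
  | succ n ih => rw [Function.iterate_succ_apply', ih, next_inl hD hf, pow_succ']; rfl

/-- An orbit still transient at time `L` would give `D₂₂ ^ L` a nonzero column. -/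
lemma exists_iterate_eq_inl (hD : D = fromBlocks (permMat σ) D₁₂ 0 D₂₂)
    (hf : ∀ j, (fun a => D a j) = Pi.single (f j) 1) (hnil : IsNilpotent D₂₂) :
    ∃ L : ℕ, ∀ b, ∃ x, f^[L] b = Sum.inl x := by
  obtain ⟨L, hL⟩ := hnil
  refine ⟨L, ?_⟩
  rintro (x | b)
  · exact ⟨_, iterate_inl hD hf L x⟩
  · rcases he : f^[L] (Sum.inr b) with x | c
    · exact ⟨x, rfl⟩
    · have h := congrFun (pow_mulVec_single hD hf L b c he) c
      simp [hL] at h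

/-- A path that follows the backbone for `K + L` steps is on a recurrent orbit for the last `K`
of them. -/
lemma exists_recurrent_path (hD : D = fromBlocks (permMat σ) D₁₂ 0 D₂₂)
    (hf : ∀ j, (fun a => D a j) = Pi.single (f j) 1) {L : ℕ}
    (hL : ∀ b, ∃ x, f^[L] b = Sum.inl x) (u : ℕ → State m r) (K j : ℕ)
    (hu : ∀ i < K + L, u (j + i + 1) = f (u (j + i))) :
    ∃ x', ∀ n ≤ K, u (j + (K + L) - n) = Sum.inl ((σ ^ (-(n : ℤ))) x') := by
  have h1 : ∀ i ≤ K + L, u (j + i) = f^[i] (u j) := by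
    intro i hi
    induction i with
    | zero => rfl
    | succ i ih =>
      rw [← add_assoc, hu i (by omega), ih (by omega), Function.iterate_succ_apply']
  obtain ⟨v, hv⟩ := hL (u j)
  -- `v` is the state after the `L` absorbing steps; the witness is the final state, `K` steps
  -- later.
  refine ⟨(σ ^ K) v, fun n hn => ?_⟩
  have e : j + (K + L) - n = j + ((K - n) + L) := by omega
  rw [e, h1 _ (by omega), Function.iterate_add_apply, hv, iterate_inl hD hf,
    ← Equiv.Perm.mul_apply, ← zpow_natCast σ K, ← _root_.zpow_add, ← zpow_natCast]
  congr 3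
  omega

lemma drift_bounds (hf : ∀ j, (fun a => D a j) = Pi.single (f j) 1) (hQ : IsDrift D Q)
    (b : State m r) : (∀ a, a ≠ f b → 0 ≤ Q a b) ∧
      Q (f b) b = -∑ a ∈ Finset.univ.erase (f b), Q a b :=
  hQ b (f b) (by simpa using congrFun (hf b) (f b))

lemma qMin_le (hf : ∀ j, (fun a => D a j) = Pi.single (f j) 1) (b : State m r) :
    qMin D Q ≤ Q (f b) b := by
  have h : ∑ i, D i b * Q i b = Q (f b) b := by
    have h1 : ∀ i, D i b = (Pi.single (f b) 1 : State m r → ℝ) i := fun i => congrFun (hf b) i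
    rw [Finset.sum_eq_single (f b)]
    · simp [h1]
    · intro i _ hi
      simp [h1, Pi.single_eq_of_ne hi]
    · simp
  rw [← h]
  exact ciInf_le (Set.finite_range _).bddBelow b

lemma drift_nonpos (hf : ∀ j, (fun a => D a j) = Pi.single (f j) 1) (hQ : IsDrift D Q)
    (b : State m r) : Q (f b) b ≤ 0 := by
  obtain ⟨h1, h2⟩ := drift_bounds hf hQ b
  rw [h2, neg_nonpos]
  exact Finset.sum_nonneg fun a ha => h1 a (Finset.ne_of_mem_erase ha)

lemma drift_le (hf : ∀ j, (fun a => D a j) = Pi.single (f j) 1) (hQ : IsDrift D Q)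
    {a b : State m r} (hab : a ≠ f b) : Q a b ≤ -Q (f b) b := by
  obtain ⟨h1, h2⟩ := drift_bounds hf hQ b
  rw [h2, neg_neg]
  exact Finset.single_le_sum (f := fun a => Q a b)
    (fun a ha => h1 a (Finset.ne_of_mem_erase ha)) (by simpa using hab)

lemma qMin_neg (hf : ∀ j, (fun a => D a j) = Pi.single (f j) 1) (hQ : IsDrift D Q)
    (hne : Q ≠ 0) : qMin D Q < 0 := by
  by_contra! h
  refine hne ?_
  have h0 : ∀ b, Q (f b) b = 0 := fun b =>
    le_antisymm (drift_nonpos hf hQ b) (h.trans (qMin_le hf b))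
  ext a b
  by_cases hab : a = f b
  · rw [hab, h0]; rfl
  · refine le_antisymm ?_ ((drift_bounds hf hQ b).1 a hab)
    have := drift_le hf hQ hab
    rw [h0] at this
    simpa using this

lemma transition_next (hf : ∀ j, (fun a => D a j) = Pi.single (f j) 1) (ε : ℝ)
    (b : State m r) : (D + ε • Q) (f b) b = 1 + ε * Q (f b) b := by
  have h1 : D (f b) b = 1 := by simpa using congrFun (hf b) (f b)
  simp [h1]

/-- Off the backbone, an entry of `Q` is at most the sum of all such entries in its column, which is
at most `-q_min`. -/
lemma transition_le_one (hf : ∀ j, (fun a => D a j) = Pi.single (f j) 1) (hQ : IsDrift D Q)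
    {ε : ℝ} (hε : 0 ≤ ε) (hε1 : -qMin D Q * ε ≤ 1) (a b : State m r) :
    (D + ε • Q) a b ≤ 1 := by
  by_cases hab : a = f b
  · rw [hab, transition_next hf]
    nlinarith [drift_nonpos hf hQ b]
  · have h1 : D a b = 0 := by
      have := congrFun (hf b) a
      rwa [Pi.single_eq_of_ne hab] at this
    simp only [Matrix.add_apply, Matrix.smul_apply, smul_eq_mul, h1, zero_add]
    have h2 := drift_le hf hQ hab
    have h3 := qMin_le (Q := Q) hf b
    have h4 := mul_le_mul_of_nonneg_left (h2.trans (neg_le_neg h3)) hε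
    linarith

end backbone

/-! ### The error bound at a fixed noise level -/

section bound

variable {m r S : ℕ}

/-- The exponent of the error bound for a single pair of states. -/
lemma exists_window_exponent_le {σ : Equiv.Perm (Fin m)} {F : Matrix (Fin S) (Fin m) ℝ}
    (hF : ∀ s x, 0 < F s x) (h1 : ∀ x, ∑ s, F s x = 1) (w0 : Fin m → ℝ) {lam α : ℝ}
    (hα : IsLargeWindow σ F w0 lam α) {x' x : Fin m} (hx : x ≠ x') :
    ∃ C η : ℝ, 0 < η ∧ ∀ δ : ℝ, 0 < δ → δ ≤ 1 / 2 →
      1 / (permOrder σ : ℝ) * ((1 - δ) ^ ⌈α / δ⌉₊ * (2 * logitBound F w0) / δ)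
        + ∑ n ∈ Finset.range ⌈α / δ⌉₊,
          logMGF σ F x' x n (-(1 / (permOrder σ : ℝ)) * (1 - δ) ^ n)
        ≤ C - (lam + η) / δ := by
  obtain ⟨hα0, hα⟩ := hα
  obtain ⟨C, hC⟩ := exists_sum_logMGF_le (σ := σ) hF h1 x' x hα0
  have hM : (0 : ℝ) < permOrder σ := by exact_mod_cast permOrder_pos σ
  have hv := hα x' x hx
  set d := ∑ n ∈ lagSet σ F x' x, 1 / (permOrder σ : ℝ) * klDiv σ F x' x n
  set ρ := rateIntegral σ F x' x
  set W := logitBound F w0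
  have hW : 0 ≤ W := logitBound_nonneg _
  -- `η` is the slack in the large-window inequality, divided by `M`.
  refine ⟨C, -(ρ + lam * permOrder σ + Real.exp (-α) * (d + 2 * W)) / permOrder σ,
    div_pos (by linarith) hM, fun δ hδ hδ2 => ?_⟩
  have hpow : (1 - δ) ^ ⌈α / δ⌉₊ ≤ Real.exp (-α) := by
    have hK := Nat.le_ceil (α / δ)
    rw [div_le_iff₀ hδ] at hK
    calc (1 - δ) ^ ⌈α / δ⌉₊ ≤ Real.exp (-δ) ^ ⌈α / δ⌉₊ :=
          pow_le_pow_left₀ (by linarith) (Real.one_sub_le_exp_neg δ) _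
      _ = Real.exp (⌈α / δ⌉₊ * -δ) := (Real.exp_nat_mul _ _).symm
      _ ≤ Real.exp (-α) := Real.exp_le_exp.2 (by linarith)
  have h2 : 1 / (permOrder σ : ℝ) * ((1 - δ) ^ ⌈α / δ⌉₊ * (2 * W) / δ)
      ≤ 1 / (permOrder σ : ℝ) * (Real.exp (-α) * (2 * W) / δ) := by gcongr
  refine (add_le_add h2 (hC δ hδ hδ2)).trans (le_of_eq ?_)
  field_simp
  ring

variable {Ω : Type*} [MeasurableSpace Ω] {μ : Measure Ω}
  {X : ℕ → Ω → State m r} {Y : ℕ → Ω → Fin S} {π₀ : State m r → ℝ}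
  {T : Matrix (State m r) (State m r) ℝ} {E : Matrix (Fin S) (State m r) ℝ}

lemma recEmission_sum (hE : IsColumnStochastic E) (x : Fin m) : ∑ s, recEmission E s x = 1 :=
  hE.2 (Sum.inl x)

/-- The probability that the last `K` states are recurrent and end in `x'`, while the filter does
not prefer `x'` to `x`. -/
lemma IsHMM.measureReal_pair_le (h : IsHMM μ X Y π₀ T E) (hE : IsColumnStochastic E)
    (hEpos : ∀ s x, 0 < recEmission E s x) (hT : ∀ a b, T a b ≤ 1) (σ : Equiv.Perm (Fin m))
    (w0 : Fin m → ℝ) {δ : ℝ} (hδ : 0 < δ) (hδ1 : δ < 1) {K k : ℕ} (hK : K ≤ k)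
    (x' x : Fin m) :
    μ.real {ω | (∀ n < K, X (k - n) ω = Sum.inl ((σ ^ (-(n : ℤ))) x')) ∧
        recLogit σ (recEmission E) δ w0 (fun i => Y i ω) k x'
          ≤ recLogit σ (recEmission E) δ w0 (fun i => Y i ω) k x}
      ≤ Real.exp (1 / (permOrder σ : ℝ)
            * ((1 - δ) ^ K * (2 * logitBound (recEmission E) w0) / δ)
          + ∑ n ∈ Finset.range K,
            logMGF σ (recEmission E) x' x n (-(1 / (permOrder σ : ℝ)) * (1 - δ) ^ n)) := by
  have := h.prob
  set c := 1 / (permOrder σ : ℝ) with hc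
  have hc0 : 0 < c := inv_permOrder_pos σ
  set F := recEmission E with hF
  -- Scaling by the Chernoff parameter `c = 1/M` makes the factor at lag `n` equal to `exp
  -- (Λ_n(-(1-δ)^n/M))`.
  have hsub : {ω | (∀ n < K, X (k - n) ω = Sum.inl ((σ ^ (-(n : ℤ))) x')) ∧
        recLogit σ F δ w0 (fun i => Y i ω) k x' ≤ recLogit σ F δ w0 (fun i => Y i ω) k x}
      ⊆ {ω | (∀ n < K, X (k - n) ω = Sum.inl ((σ ^ (-(n : ℤ))) x')) ∧
        ∑ n ∈ Finset.range K, c * ((1 - δ) ^ n * logRatio σ F x' x n (Y (k - n) ω))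
          ≤ c * ((1 - δ) ^ K * (2 * logitBound F w0) / δ)} := by
    rintro ω ⟨h1, h2⟩
    refine ⟨h1, ?_⟩
    rw [← Finset.mul_sum]
    exact mul_le_mul_of_nonneg_left
      (window_sum_le_of_recLogit_le σ hEpos hδ hδ1 w0 (fun i => Y i ω) hK h2) hc0.le
  refine (measureReal_mono hsub (measure_ne_top _ _)).trans
    ((h.measureReal_window_le hE.1 hT K k hK
      (fun n => Sum.inl ((σ ^ (-(n : ℤ))) x'))
      (fun n s => c * ((1 - δ) ^ n * logRatio σ F x' x n s)) _).trans (le_of_eq ?_))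
  rw [Real.exp_add, Real.exp_sum]
  congr 1
  refine Finset.prod_congr rfl fun n _ => ?_
  rw [logMGF_eq_cgf, exp_cgf (fun s => hEpos s _) (recEmission_sum hE _)]
  refine Finset.sum_congr rfl fun s _ => ?_
  congr 2
  ring

lemma IsHMM.errProb_le (h : IsHMM μ X Y π₀ T E) (hE : IsColumnStochastic E)
    (hEpos : ∀ s x, 0 < recEmission E s x) (hT : ∀ a b, T a b ≤ 1) {σ : Equiv.Perm (Fin m)}
    {D₁₂ : Matrix (Fin m) (Fin r) ℝ} {D₂₂ : Matrix (Fin r) (Fin r) ℝ}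
    {D : Matrix (State m r) (State m r) ℝ} {f : State m r → State m r}
    (hD : D = fromBlocks (permMat σ) D₁₂ 0 D₂₂)
    (hf : ∀ j, (fun a => D a j) = Pi.single (f j) 1) {L : ℕ}
    (hL : ∀ b, ∃ x, f^[L] b = Sum.inl x) {c : ℝ} (hc : ∀ b, 1 - T (f b) b ≤ c)
    (w0 : Fin m → ℝ) {δ : ℝ} (hδ : 0 < δ) (hδ1 : δ < 1) {K k : ℕ} (hK : K + L ≤ k)
    {b : Fin m × Fin m → ℝ}
    (hb : ∀ x' x, x ≠ x' → 1 / (permOrder σ : ℝ)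
            * ((1 - δ) ^ K * (2 * logitBound (recEmission E) w0) / δ)
          + ∑ n ∈ Finset.range K,
            logMGF σ (recEmission E) x' x n (-(1 / (permOrder σ : ℝ)) * (1 - δ) ^ n)
          ≤ b (x', x)) :
    errProb μ X Y σ E w0 δ k ≤ c * (K + L) + ∑ p, Real.exp (b p) := by
  have := h.prob
  obtain ⟨j, rfl⟩ : ∃ j, k = j + (K + L) := ⟨k - (K + L), by omega⟩
  set P : Fin m × Fin m → Set Ω := fun p =>
    {ω | p.2 ≠ p.1 ∧ (∀ n < K, X (j + (K + L) - n) ω = Sum.inl ((σ ^ (-(n : ℤ))) p.1)) ∧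
        recLogit σ (recEmission E) δ w0 (fun i => Y i ω) (j + (K + L)) p.1
          ≤ recLogit σ (recEmission E) δ w0 (fun i => Y i ω) (j + (K + L)) p.2} with hP
  have hsub : {ω | argmax (alf σ E δ w0 (fun i => Y i ω) (j + (K + L))) ≠ {X (j + (K + L)) ω}}
      ⊆ (⋃ i ∈ Finset.range (K + L), {ω | X (j + i + 1) ω ≠ f (X (j + i) ω)})
        ∪ ⋃ p ∈ Finset.univ, P p := by
    intro ω hω
    by_cases hj : ∀ i < K + L, X (j + i + 1) ω = f (X (j + i) ω)
    · right
      obtain ⟨x', hx'⟩ := exists_recurrent_path hD hf hL (fun t => X t ω) K j hj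
      have h0 : X (j + (K + L)) ω = Sum.inl x' := by simpa using hx' 0 (Nat.zero_le _)
      have hω' : argmax (alf σ E δ w0 (fun i => Y i ω) (j + (K + L))) ≠ {Sum.inl x'} := by
        rw [← h0]; exact hω
      obtain ⟨x, hx, hle⟩ := exists_recLogit_le σ hEpos hδ1 w0 _ _ hω'
      simp only [Finset.mem_univ, Set.iUnion_true, Set.mem_iUnion]
      exact ⟨(x', x), hx, fun n hn => hx' n hn.le, hle⟩
    · left
      push Not at hj
      obtain ⟨i, hi, hne⟩ := hj
      simp only [Set.mem_iUnion]
      exact ⟨i, Finset.mem_range.2 hi, hne⟩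
  have h1 : μ.real (⋃ i ∈ Finset.range (K + L), {ω | X (j + i + 1) ω ≠ f (X (j + i) ω)})
      ≤ c * (K + L) := by
    refine (measureReal_biUnion_finset_le _ _).trans ?_
    refine (Finset.sum_le_sum fun i _ => h.measureReal_jump_le hE.2 f hc (j + i)).trans ?_
    simp [mul_comm]
  have h2 : μ.real (⋃ p ∈ Finset.univ, P p) ≤ ∑ p, Real.exp (b p) := by
    refine (measureReal_biUnion_finset_le _ _).trans (Finset.sum_le_sum ?_)
    rintro ⟨x', x⟩ _
    by_cases hx : x ≠ x'
    · have hsub' : P (x', x) ⊆ {ω | (∀ n < K, X (j + (K + L) - n) ω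
            = Sum.inl ((σ ^ (-(n : ℤ))) x')) ∧
          recLogit σ (recEmission E) δ w0 (fun i => Y i ω) (j + (K + L)) x'
            ≤ recLogit σ (recEmission E) δ w0 (fun i => Y i ω) (j + (K + L)) x} :=
        fun ω hω => hω.2
      refine (measureReal_mono hsub' (measure_ne_top _ _)).trans
        ((h.measureReal_pair_le hE hEpos hT σ w0 hδ hδ1 (by omega) x' x).trans
          (Real.exp_le_exp.2 (hb x' x hx)))
    · have : P (x', x) = ∅ := Set.eq_empty_of_forall_notMem fun ω hω => hx hω.1
      rw [this]
      simpa using (Real.exp_pos _).le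
  calc errProb μ X Y σ E w0 δ (j + (K + L)) ≤ _ := measureReal_mono hsub (measure_ne_top _ _)
    _ ≤ _ := measureReal_union_le _ _
    _ ≤ _ := add_le_add h1 h2

end bound

/-! ### Passage to the upper limit in time -/

section main

variable {m r S : ℕ}

lemma errProb_nonneg {Ω : Type*} [MeasurableSpace Ω] (μ : Measure Ω)
    (X : ℕ → Ω → State m r) (Y : ℕ → Ω → Fin S) (σ : Equiv.Perm (Fin m))
    (E : Matrix (Fin S) (State m r) ℝ) (w0 : Fin m → ℝ) (δ : ℝ) (k : ℕ) :
    0 ≤ errProb μ X Y σ E w0 δ k :=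
  measureReal_nonneg

lemma isBoundedUnder_errProb {Ω : Type*} [MeasurableSpace Ω] (μ : Measure Ω)
    [IsProbabilityMeasure μ] (X : ℕ → Ω → State m r) (Y : ℕ → Ω → Fin S)
    (σ : Equiv.Perm (Fin m)) (E : Matrix (Fin S) (State m r) ℝ) (w0 : Fin m → ℝ) (δ : ℝ) :
    IsBoundedUnder (· ≤ ·) atTop (errProb μ X Y σ E w0 δ) :=
  isBoundedUnder_of ⟨1, fun _ => measureReal_le_one⟩

lemma isCoboundedUnder_errProb {Ω : Type*} [MeasurableSpace Ω] (μ : Measure Ω)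
    (X : ℕ → Ω → State m r) (Y : ℕ → Ω → Fin S)
    (σ : Equiv.Perm (Fin m)) (E : Matrix (Fin S) (State m r) ℝ) (w0 : Fin m → ℝ) (δ : ℝ) :
    IsCoboundedUnder (· ≤ ·) atTop (errProb μ X Y σ E w0 δ) :=
  (isBoundedUnder_of ⟨0, fun k => errProb_nonneg μ X Y σ E w0 δ k⟩ :
    IsBoundedUnder (· ≥ ·) atTop _).isCoboundedUnder_le

lemma limsup_errProb_nonneg {Ω : Type*} [MeasurableSpace Ω] (μ : Measure Ω)
    [IsProbabilityMeasure μ] (X : ℕ → Ω → State m r) (Y : ℕ → Ω → Fin S)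
    (σ : Equiv.Perm (Fin m)) (E : Matrix (Fin S) (State m r) ℝ) (w0 : Fin m → ℝ) (δ : ℝ) :
    0 ≤ limsup (errProb μ X Y σ E w0 δ) atTop :=
  le_limsup_of_frequently_le
    (Eventually.of_forall fun k => errProb_nonneg μ X Y σ E w0 δ k).frequently
    (isBoundedUnder_errProb μ X Y σ E w0 δ)

/-- The asymptotic error bound at fixed small noise level and step size. -/
lemma exists_limsup_errProb_le {σ : Equiv.Perm (Fin m)} {D₁₂ : Matrix (Fin m) (Fin r) ℝ}
    {D₂₂ : Matrix (Fin r) (Fin r) ℝ} {D Q : Matrix (State m r) (State m r) ℝ}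
    (hD : D = fromBlocks (permMat σ) D₁₂ 0 D₂₂) (hDdet : IsDeterministic D)
    (hD₂₂ : IsNilpotent D₂₂) (hQ : IsDrift D Q) {E : Matrix (Fin S) (State m r) ℝ}
    (hE : IsColumnStochastic E) (hEpos : ∀ s x, 0 < recEmission E s x) (w0 : Fin m → ℝ)
    (π₀ : State m r → ℝ) (Ω : ℝ → Type*) [∀ ε, MeasurableSpace (Ω ε)]
    (μ : ∀ ε, Measure (Ω ε)) (X : ∀ ε, ℕ → Ω ε → State m r) (Y : ∀ ε, ℕ → Ω ε → Fin S)
    (hHMM : ∀ᶠ ε in 𝓝[>] (0 : ℝ), IsHMM (μ ε) (X ε) (Y ε) π₀ (D + ε • Q) E)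
    {lam α : ℝ} (hα : IsLargeWindow σ (recEmission E) w0 lam α) :
    ∃ (L : ℝ) (C η : Fin m × Fin m → ℝ), (∀ p, 0 < η p) ∧
      ∀ δ : ℝ → ℝ, (∀ᶠ ε in 𝓝[>] (0 : ℝ), 0 < δ ε) → Tendsto δ (𝓝[>] 0) (𝓝 0) →
        ∀ᶠ ε in 𝓝[>] (0 : ℝ),
          limsup (errProb (μ ε) (X ε) (Y ε) σ E w0 (δ ε)) atTop
            ≤ -qMin D Q * ε * (α / δ ε + L) + ∑ p, Real.exp (C p - (lam + η p) / δ ε) := by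
  choose f hf using hDdet
  obtain ⟨L, hL⟩ := exists_iterate_eq_inl hD hf hD₂₂
  -- Constants are chosen for all pairs at once; on the diagonal they are dummies.
  have hpair : ∀ p : Fin m × Fin m, ∃ C η : ℝ, 0 < η ∧ (p.2 ≠ p.1 →
      ∀ δ : ℝ, 0 < δ → δ ≤ 1 / 2 →
      1 / (permOrder σ : ℝ)
          * ((1 - δ) ^ ⌈α / δ⌉₊ * (2 * logitBound (recEmission E) w0) / δ)
        + ∑ n ∈ Finset.range ⌈α / δ⌉₊,
          logMGF σ (recEmission E) p.1 p.2 n (-(1 / (permOrder σ : ℝ)) * (1 - δ) ^ n)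
        ≤ C - (lam + η) / δ) := by
    intro p
    by_cases hp : p.2 ≠ p.1
    · obtain ⟨C, η, hη, h⟩ := exists_window_exponent_le hEpos (recEmission_sum hE) w0 hα hp
      exact ⟨C, η, hη, fun _ => h⟩
    · exact ⟨0, 1, one_pos, fun h => absurd h hp⟩
  choose C η hη hCη using hpair
  -- The extra `1` absorbs the ceiling in `⌈α / δ⌉₊`. All constants precede `δ`, so one bound serves
  -- both step-size regimes.
  refine ⟨1 + L, C, η, hη, fun δ hδpos hδ => ?_⟩
  have hδ2 : ∀ᶠ ε in 𝓝[>] (0 : ℝ), δ ε < 1 / 2 := hδ.eventually_lt_const (by norm_num)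
  have hεq : ∀ᶠ ε in 𝓝[>] (0 : ℝ), -qMin D Q * ε < 1 := by
    have : Tendsto (fun ε : ℝ => -qMin D Q * ε) (𝓝[>] 0) (𝓝 (-qMin D Q * 0)) :=
      (tendsto_nhdsWithin_of_tendsto_nhds tendsto_id).const_mul _
    exact this.eventually_lt_const (by simp)
  filter_upwards [hHMM, hδpos, hδ2, hεq, self_mem_nhdsWithin] with ε h hδ0 hδ2 hεq hε
  have hε : 0 < ε := hε
  have hprob := h.prob
  have hc : ∀ b, 1 - (D + ε • Q) (f b) b ≤ -qMin D Q * ε := by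
    intro b
    rw [transition_next hf]
    nlinarith [qMin_le (Q := Q) hf b]
  have hc0 : 0 ≤ -qMin D Q * ε :=
    (measureReal_nonneg).trans (h.measureReal_jump_le hE.2 f hc 0)
  refine limsup_le_of_le (isCoboundedUnder_errProb _ _ _ _ _ _ _) ?_
  filter_upwards [eventually_ge_atTop (⌈α / δ ε⌉₊ + L)] with k hk
  refine (h.errProb_le hE hEpos (transition_le_one hf hQ hε.le hεq.le) hD hf hL hc w0 hδ0
    (by linarith) hk (b := fun p => C p - (lam + η p) / δ ε)
    fun x' x hx => hCη (x', x) hx (δ ε) hδ0 hδ2.le).trans ?_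
  have hK := (Nat.ceil_lt_add_one (div_pos hα.1 hδ0).le).le
  exact add_le_add_left (mul_le_mul_of_nonneg_left (by linarith) hc0) _

lemma tendsto_log_one_div : Tendsto (fun ε : ℝ => Real.log (1 / ε)) (𝓝[>] 0) atTop := by
  simp only [one_div]
  exact Real.tendsto_log_atTop.comp tendsto_inv_nhdsGT_zero

lemma isLittleO_mul_log {b : ℝ → ℝ} {c : ℝ} (hb : Tendsto b (𝓝[>] 0) (𝓝 c)) :
    (fun ε => ε * b ε) =o[𝓝[>] (0 : ℝ)] fun ε => ε * Real.log (1 / ε) := by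
  refine (Asymptotics.isBigO_refl _ _).mul_isLittleO ?_
  refine (hb.isBigO_one ℝ).trans_isLittleO ?_
  rw [Asymptotics.isLittleO_one_left_iff]
  exact tendsto_norm_atTop_atTop.comp tendsto_log_one_div

end main

end ALF

end

/-! ### The two step-size regimes -/

theorem theorem2 {m r S : ℕ}
    -- the deterministic backbone `D = [P, D₁₂; 0, D₂₂]` and the perturbation `Q`
    (σ : Equiv.Perm (Fin m)) (D₁₂ : Matrix (Fin m) (Fin r) ℝ) (D₂₂ : Matrix (Fin r) (Fin r) ℝ)
    (D Q : Matrix (ALF.State m r) (ALF.State m r) ℝ)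
    (hD : D = Matrix.fromBlocks (ALF.permMat σ) D₁₂ 0 D₂₂)
    (hDdet : ALF.IsDeterministic D) (hD₂₂ : IsNilpotent D₂₂)
    (hQ : ALF.IsDrift D Q)
    -- the emission matrix and the observability assumption
    (E : Matrix (Fin S) (ALF.State m r) ℝ) (hE : ALF.IsColumnStochastic E)
    (hEpos : ∀ s x, 0 < ALF.recEmission E s x)
    (hEs : ∀ x x' : Fin m, x ≠ x' →
      ∃ a, ALF.stacked σ (ALF.recEmission E) a x ≠ ALF.stacked σ (ALF.recEmission E) a x')
    -- the initial logits on the recurrent states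
    (w0 : Fin m → ℝ)
    -- for every small `ε`, a hidden Markov model with transition matrix `D + ε Q`
    (π₀ : ALF.State m r → ℝ) (hπ₀ : (∀ x, 0 ≤ π₀ x) ∧ ∑ x, π₀ x = 1)
    (Ω : ℝ → Type*) [∀ ε, MeasurableSpace (Ω ε)] (μ : ∀ ε, Measure (Ω ε))
    (X : ∀ ε, ℕ → Ω ε → ALF.State m r) (Y : ∀ ε, ℕ → Ω ε → Fin S)
    (hHMM : ∀ᶠ ε in 𝓝[>] (0 : ℝ), ALF.IsHMM (μ ε) (X ε) (Y ε) π₀ (D + ε • Q) E) :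
    (∀ δ : ℝ → ℝ, (∀ᶠ ε in 𝓝[>] (0 : ℝ), 0 < δ ε) →
      Tendsto δ (𝓝[>] 0) (𝓝 0) → Tendsto (fun ε => ε / δ ε) (𝓝[>] 0) (𝓝 0) →
      Tendsto (fun ε => limsup (ALF.errProb (μ ε) (X ε) (Y ε) σ E w0 (δ ε)) atTop)
        (𝓝[>] 0) (𝓝 0)) ∧
    0 < ALF.xi σ (ALF.recEmission E) ∧
    ∀ lam : ℝ, 0 < lam → (lam : EReal) < ALF.xi σ (ALF.recEmission E) →
      (∃ α, ALF.IsLargeWindow σ (ALF.recEmission E) w0 lam α) ∧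
      ∀ α, ALF.IsLargeWindow σ (ALF.recEmission E) w0 lam α →
        (Q ≠ 0 → 0 < ALF.kappa D Q lam α) ∧
        ∃ R : ℝ → ℝ,
          R =o[𝓝[>] (0 : ℝ)] (fun ε => ε * Real.log (1 / ε)) ∧
          ∀ᶠ ε in 𝓝[>] (0 : ℝ),
            limsup (ALF.errProb (μ ε) (X ε) (Y ε) σ E w0 (lam / Real.log (1 / ε))) atTop
              ≤ ALF.kappa D Q lam α * (ε * Real.log (1 / ε)) + R ε := by
  have hsum := ALF.recEmission_sum hE
  refine ⟨fun δ hδ0 hδ hεδ => ?_, ALF.xi_pos hEpos hsum hEs, fun lam hlam hlamxi => ⟨?_, ?_⟩⟩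
  -- With `lam = 0` the window condition only needs `ρ < 0`, and the exponents still tend to `-∞`
  -- because `η > 0` and `δ → 0`.
  · obtain ⟨α, hα⟩ := ALF.exists_isLargeWindow (σ := σ) (F := ALF.recEmission E) w0 (lam := 0)
      fun x' x hx => by simpa using ALF.rateIntegral_neg hEpos hsum (hEs x x' hx)
    obtain ⟨L, C, η, hη, h⟩ := ALF.exists_limsup_errProb_le hD hDdet hD₂₂ hQ hE hEpos w0 π₀ Ω μ
      X Y hHMM hα
    have hid : Tendsto (fun ε : ℝ => ε) (𝓝[>] 0) (𝓝 0) :=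
      tendsto_nhdsWithin_of_tendsto_nhds tendsto_id
    have hinv : Tendsto (fun ε => (δ ε)⁻¹) (𝓝[>] 0) atTop :=
      tendsto_inv_nhdsGT_zero.comp (tendsto_nhdsWithin_iff.2 ⟨hδ, hδ0⟩)
    have hlim : Tendsto (fun ε => -ALF.qMin D Q * ε * (α / δ ε + L)
        + ∑ p, Real.exp (C p - (0 + η p) / δ ε)) (𝓝[>] 0) (𝓝 0) := by
      have h1 : Tendsto (fun ε => -ALF.qMin D Q * (α * (ε / δ ε) + L * ε)) (𝓝[>] 0)
          (𝓝 (-ALF.qMin D Q * (α * 0 + L * 0))) :=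
        ((hεδ.const_mul α).add (hid.const_mul L)).const_mul _
      have h2 : Tendsto (fun ε => ∑ p, Real.exp (C p - (0 + η p) / δ ε)) (𝓝[>] 0)
          (𝓝 (∑ _p : Fin m × Fin m, 0)) := by
        refine tendsto_finsetSum _ fun p _ => Real.tendsto_exp_atBot.comp ?_
        simp only [zero_add, div_eq_mul_inv, sub_eq_add_neg]
        exact tendsto_atBot_add_const_left _ _
          (tendsto_neg_atTop_atBot.comp (hinv.const_mul_atTop (hη p)))
      have h3 := h1.add h2
      simp only [mul_zero, add_zero, Finset.sum_const_zero] at h3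
      refine h3.congr fun ε => ?_
      congr 1
      ring
    refine tendsto_of_tendsto_of_tendsto_of_le_of_le' tendsto_const_nhds hlim ?_ (h δ hδ0 hδ)
    filter_upwards [hHMM] with ε hε
    have := hε.prob
    exact ALF.limsup_errProb_nonneg _ _ _ _ _ _ _
  · exact ALF.exists_isLargeWindow w0 fun x' x hx => ALF.rateIntegral_add_neg_of_lt_xi hlamxi hx
  · intro α hα
    refine ⟨fun hQ0 => ?_, ?_⟩
    · choose f hf using hDdet
      exact div_pos (mul_pos (neg_pos.2 (ALF.qMin_neg hf hQ hQ0)) hα.1) hlam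
    · obtain ⟨L, C, η, hη, h⟩ := ALF.exists_limsup_errProb_le hD hDdet hD₂₂ hQ hE hEpos w0 π₀ Ω
        μ X Y hHMM hα
      have hlogpos := ALF.tendsto_log_one_div.eventually_gt_atTop 0
      -- This is the remainder divided by `ε`: the `L` extra steps contribute a constant, the filter
      -- errors a vanishing term.
      have hb : Tendsto (fun ε => -ALF.qMin D Q * L
          + ∑ p, Real.exp (C p - η p / lam * Real.log (1 / ε))) (𝓝[>] 0)
          (𝓝 (-ALF.qMin D Q * L + ∑ _p : Fin m × Fin m, 0)) := by
        refine tendsto_const_nhds.add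
          (tendsto_finsetSum _ fun p _ => Real.tendsto_exp_atBot.comp ?_)
        simp only [sub_eq_add_neg]
        exact tendsto_atBot_add_const_left _ _ (tendsto_neg_atTop_atBot.comp
          (ALF.tendsto_log_one_div.const_mul_atTop (div_pos (hη p) hlam)))
      refine ⟨_, ALF.isLittleO_mul_log hb, ?_⟩
      have hδ0 : ∀ᶠ ε in 𝓝[>] (0 : ℝ), 0 < lam / Real.log (1 / ε) :=
        hlogpos.mono fun ε hε => div_pos hlam hε
      filter_upwards [h _ hδ0 (ALF.tendsto_log_one_div.const_div_atTop lam), hlogpos,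
        self_mem_nhdsWithin] with ε hle hlog hε
      have hε : 0 < ε := hε
      refine hle.trans (le_of_eq ?_)
      -- For this step size `exp (-lam / δ)` is exactly `ε`, and `η` leaves a further positive power
      -- of `ε`.
      have hexp : ∀ p, Real.exp (C p - (lam + η p) / (lam / Real.log (1 / ε)))
          = ε * Real.exp (C p - η p / lam * Real.log (1 / ε)) := by
        intro p
        nth_rw 2 [← Real.exp_log hε]
        rw [← Real.exp_add]
        congr 1
        rw [one_div, Real.log_inv] at *
        field_simp
        ring
      simp only [hexp]
      rw [← Finset.mul_sum, ALF.kappa]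
      field_simp
      ring
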